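/- Fix $m\in\mathbb N$. An ID-generation algorithm $\mathcal A$ is a probability distribution on the permutations of $[m]=\{1,\dots,m\}$; an instance of $\mathcal A$ draws a permutation and returns the IDs in that order. A non-trivial demand profile is a vector $D=(d_1,\dots,d_n)\in[m]^n$ with $n\ge 2$; $p_{\mathcal A}(D)$ denotes the probability that, when $n$ independent instances of $\mathcal A$ return $d_1,\dots,d_n$ IDs respectively, the sets of returned IDs are not pairwise disjoint (a collision), and $p_*(D)=\min_{\mathcal A'}p_{\mathcal A'}(D)$. For a set $\mathcal D$ of non-trivial demand profiles, the competitive ratio of $\mathcal A$ for $\mathcal D$ is $\sup_{D\in\mathcal D}p_{\mathcal A}(D)/p_*(D)$. An adaptive adversary $Z$ (possibly randomized) starts with the empty profile and, in each step, either activates a new independent instance of $\mathcal A$ and requests one ID from it (appending an entry $1$ to the profile), or requests one more ID from an already active instance (incrementing its entry), or stops; it sees every ID returned, and its decisions may depend on them. $\mathrm{Adv}(\mathcal D)$ is the set of adversaries that always stop eventually, with a final profile in $\mathcal D$. Let $p_{\mathcal A}(Z)$ be the probability that a collision has occurred when the game ends, and let $\mathbb E_{D\sim Z}[p_*(D)]$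 be the expectation of $p_*$ at the final profile of the game between $Z$ and $\mathcal A$. The competitive ratio of $\mathcal A$ for $\mathrm{Adv}(\mathcal D)$ is $\sup_{Z\in\mathrm{Adv}(\mathcal D)}p_{\mathcal A}(Z)/\mathbb E_{D\sim Z}[p_*(D)]$. For $k\in[m]$, $\mathrm{BINS}(k)$ divides $[m]$ into $\lfloor m/k\rfloor$ consecutive bins of $k$ IDs and $m\bmod k$ leftover IDs, goes through the bins in a uniformly random order, returning the IDs of each bin in increasing order, and finally returns the leftover IDs in increasing order. $\mathrm{BINS}^*$ (for $m\ge 2$) uses $C=\lceil\log_2 m-\log_2\log_2 m\rceil$ consecutive disjoint chunks of $2^{C-1}$ IDs each, the $i$th of which is divided into $2^{C-i}$ consecutive bins of $2^{i-1}$ IDs; for $i=1,\dots,C$ in turn it picks, independently, a uniformly random bin of the $i$th chunk and returns its IDs in increasing order. This specifies the first $2^C-1$ IDs; the order of the remaining ones may be completed in any way. **Theorem.** Let $\mathcal D$ be a set of non-trivial demand profiles, and let $\mathcal A$ be either $\mathrm{BINS}(k)$ for some $k\in[m]$, or $\mathrm{BINS}^*$, where in the latter case all entries of the profiles in $\mathcal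 D$ are at most $2^C-1$. If $\mathcal A$ has competitive ratio $c$ for $\mathcal D$, then $\mathcal A$ has competitive ratio at most $4c$ for $\mathrm{Adv}(\mathcal D)$. -/

import Mathlib

open scoped ENNReal

noncomputable section

namespace UUID

/-! ### Algorithms, demand profiles, collisions

IDs are the elements of `Fin m`.  An ID-generation algorithm is a probability distribution on
the permutations of the ID space; under the outcome `σ` the IDs are produced in the order
`σ 0, σ 1, …, σ (m - 1)`. -/

/-- An ID-generation algorithm over a universe of `m` IDs. -/
abbrev Algorithm (m : ℕ) := PMF (Equiv.Perm (Fin m))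

/-- A demand profile `(d₁, …, dₙ)`, for an arbitrary number `n` of instances. -/
abbrev Profile := Σ n : ℕ, (Fin n → ℕ)

/-- A non-trivial demand profile: `n ≥ 2` instances, with demands in `{1, …, m}`. -/
def Profile.Nontrivial (m : ℕ) (D : Profile) : Prop :=
  2 ≤ D.1 ∧ ∀ i, 1 ≤ D.2 i ∧ D.2 i ≤ m

/-- If instance `i` produces its IDs in the order `σ i` and is asked for `D i` of them, then the
sets of IDs produced by the instances are not pairwise disjoint. -/
def Collision {m n : ℕ} (σ : Fin n → Equiv.Perm (Fin m)) (D : Fin n → ℕ) : Prop :=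
  ∃ i j : Fin n, i ≠ j ∧ ∃ a b : Fin m, (a : ℕ) < D i ∧ (b : ℕ) < D j ∧ σ i a = σ j b

open Classical in
/-- The probability `p_A(D)` of a collision when `n` independent instances of `A` serve `D`. -/
def collisionProb {m : ℕ} (A : Algorithm m) (D : Profile) : ℝ≥0∞ :=
  ∑ σ : Fin D.1 → Equiv.Perm (Fin m), if Collision σ D.2 then ∏ i, A (σ i) else 0

/-- The best possible collision probability `p_*(D)`. -/
def optProb (m : ℕ) (D : Profile) : ℝ≥0∞ :=
  ⨅ A : Algorithm m, collisionProb A D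

/-- The competitive ratio of `A` for a set of demand profiles (oblivious adversaries). -/
def competitiveRatio {m : ℕ} (A : Algorithm m) (𝒟 : Set Profile) : ℝ≥0∞ :=
  ⨆ D ∈ 𝒟, collisionProb A D / optProb m D

/-! ### Adaptive adversaries -/

/-- `Adversary m D` is the type of (possibly randomized) strategies of an adaptive adversary from
the moment when the current demand profile is `D`.  The adversary stops, or activates a new
instance, or requests a further ID from an active instance; in the last two cases it learns the ID
that is produced, and continues depending on it.  It may also toss a (biased, many-sided) coin.
A strategy is a well-founded tree, so the game always ends. -/
inductive Adversary (m : ℕ) : {n : ℕ} → (Fin n → ℕ) → Type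
  | halt {n : ℕ} {D : Fin n → ℕ} : Adversary m D
  | activate {n : ℕ} {D : Fin n → ℕ} (hm : 0 < m)
      (next : Fin m → Adversary m (Fin.snoc (α := fun _ => ℕ) D 1)) : Adversary m D
  | request {n : ℕ} {D : Fin n → ℕ} (j : Fin n) (hj : D j < m)
      (next : Fin m → Adversary m (Function.update D j (D j + 1))) : Adversary m D
  | toss {n : ℕ} {D : Fin n → ℕ} (μ : PMF ℕ) (next : ℕ → Adversary m D) : Adversary m D

/-- The outcome of a game: the number of activated instances, the orders in which they produce
their IDs, and the final demand profile. -/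
abbrev Outcome (m : ℕ) := Σ n : ℕ, (Fin n → Equiv.Perm (Fin m)) × (Fin n → ℕ)

/-- The final demand profile of a game. -/
def Outcome.profile {m : ℕ} (o : Outcome m) : Profile := ⟨o.1, o.2.2⟩

/-- The law of the outcome, when the instances active so far have drawn the orders `σ` (which the
adversary does not see).  Every newly activated instance draws its order from `A`, independently
of everything else. -/
def Adversary.play {m : ℕ} (A : Algorithm m) : {n : ℕ} → {D : Fin n → ℕ} →
    Adversary m D → (Fin n → Equiv.Perm (Fin m)) → PMF (Outcome m)
  | n, D, .halt, σ => PMF.pure ⟨n, σ, D⟩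
  | _, _, .activate hm next, σ =>
      A.bind fun τ => (next (τ ⟨0, hm⟩)).play A
        (Fin.snoc (α := fun _ => Equiv.Perm (Fin m)) σ τ)
  | _, D, .request j hj next, σ => (next (σ j ⟨D j, hj⟩)).play A σ
  | _, _, .toss μ next, σ => μ.bind fun r => (next r).play A σ

/-- Adaptive adversaries for the whole game, which starts at the empty profile. -/
abbrev Adaptive (m : ℕ) := Adversary m (![] : Fin 0 → ℕ)

/-- The law of the outcome of the game between `Z` and the instances of `A`. -/
def game {m : ℕ} (A : Algorithm m) (Z : Adaptive m) : PMF (Outcome m) :=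
  Z.play A ![]

open Classical in
/-- The probability `p_A(Z)` that a collision occurs in the game. -/
def adaptiveCollisionProb {m : ℕ} (A : Algorithm m) (Z : Adaptive m) : ℝ≥0∞ :=
  ∑' o : Outcome m, if Collision o.2.1 o.2.2 then game A Z o else 0

/-- The expectation of `p_*(D)` over the final demand profile `D` of the game. -/
def expectedOptProb {m : ℕ} (A : Algorithm m) (Z : Adaptive m) : ℝ≥0∞ :=
  ∑' o : Outcome m, game A Z o * optProb m o.profile

/-- `Adv(𝒟)`: the adversaries whose game against `A` can only end with a final demand profile
in `𝒟`. -/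
def Adv {m : ℕ} (A : Algorithm m) (𝒟 : Set Profile) : Set (Adaptive m) :=
  {Z | ∀ o ∈ (game A Z).support, o.profile ∈ 𝒟}

/-- The competitive ratio of `A` for `Adv(𝒟)`. -/
def adaptiveCompetitiveRatio {m : ℕ} (A : Algorithm m) (𝒟 : Set Profile) : ℝ≥0∞ :=
  ⨆ Z ∈ Adv A 𝒟, adaptiveCollisionProb A Z / expectedOptProb A Z

/-! ### The algorithm `BINS(k)` -/

/-- The `t`-th ID when the `⌊m/k⌋` bins `{rk, …, rk + k - 1}` are traversed in the order `π`, and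
then the leftover IDs in increasing order. -/
def binsFun (m k : ℕ) (π : Equiv.Perm (Fin (m / k))) (t : ℕ) : ℕ :=
  if h : t / k < m / k then (π ⟨t / k, h⟩ : ℕ) * k + t % k else t

theorem binsFun_lt (m k : ℕ) (π : Equiv.Perm (Fin (m / k))) {t : ℕ} (ht : t < m) :
    binsFun m k π t < m := by
  unfold binsFun
  split_ifs with h
  · have hk : 0 < k := by
      rcases Nat.eq_zero_or_pos k with rfl | hk
      · simp at h
      · exact hk
    have h1 := (π ⟨t / k, h⟩).isLt
    have h2 := Nat.mod_lt t hk
    have h3 : ((π ⟨t / k, h⟩ : ℕ) + 1) * k ≤ m / k * k := Nat.mul_le_mul_right k h1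
    have h4 := Nat.div_mul_le_self m k
    rw [Nat.add_mul] at h3
    omega
  · exact ht

theorem binsFun_symm (m k : ℕ) (π : Equiv.Perm (Fin (m / k))) (t : ℕ) :
    binsFun m k π.symm (binsFun m k π t) = t := by
  by_cases h : t / k < m / k
  · have hk : 0 < k := by
      rcases Nat.eq_zero_or_pos k with rfl | hk
      · simp at h
      · exact hk
    have e : binsFun m k π t = (π ⟨t / k, h⟩ : ℕ) * k + t % k := by simp [binsFun, h]
    have e1 : binsFun m k π t / k = (π ⟨t / k, h⟩ : ℕ) := by
      rw [e, Nat.add_comm, Nat.add_mul_div_right _ _ hk,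
        Nat.div_eq_of_lt (Nat.mod_lt t hk), Nat.zero_add]
    have e2 : binsFun m k π t % k = t % k := by
      rw [e, Nat.add_comm, Nat.add_mul_mod_self_right, Nat.mod_mod]
    conv_lhs => rw [binsFun]
    simp only [e1, e2, Fin.is_lt, dite_true, Fin.eta, Equiv.symm_apply_apply]
    exact Nat.div_add_mod' t k
  · have e : binsFun m k π t = t := by simp [binsFun, h]
    rw [e]
    simp [binsFun, h]

/-- The order of the IDs in `BINS(k)`, given the order `π` of the bins. -/
def binsPerm (m k : ℕ) (π : Equiv.Perm (Fin (m / k))) : Equiv.Perm (Fin m) where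
  toFun t := ⟨binsFun m k π t, binsFun_lt m k π t.isLt⟩
  invFun t := ⟨binsFun m k π.symm t, binsFun_lt m k π.symm t.isLt⟩
  left_inv t := Fin.ext (binsFun_symm m k π t)
  right_inv t := Fin.ext (by simpa using binsFun_symm m k π.symm t)

/-- The algorithm `BINS(k)`: the bins come in a uniformly random order. -/
def bins (m k : ℕ) : Algorithm m :=
  (PMF.uniformOfFintype (Equiv.Perm (Fin (m / k)))).map (binsPerm m k)

/-! ### The algorithm `BINS*` -/

/-- The number of chunks, `C = ⌈log m - log log m⌉` with logarithms to base 2. -/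
def chunks (m : ℕ) : ℕ := ⌈Real.logb 2 m - Real.logb 2 (Real.logb 2 m)⌉₊

theorem two_pow_chunks_le (m : ℕ) : 2 ^ chunks m ≤ m + 1 := by
  rcases Nat.lt_or_ge m 2 with h | h
  · have : chunks m = 0 := by
      interval_cases m <;> simp [chunks]
    rw [this]
    omega
  have hm : (0 : ℝ) < m := by positivity
  have hl : 1 ≤ Real.logb 2 m := by
    rw [Real.le_logb_iff_rpow_le (by norm_num) hm]
    norm_num
    exact_mod_cast h
  have hl0 : 0 < Real.logb 2 m := by linarith
  have e : Real.logb 2 m - Real.logb 2 (Real.logb 2 m) = Real.logb 2 (m / Real.logb 2 m) :=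
    (Real.logb_div hm.ne' hl0.ne').symm
  rcases Nat.lt_or_ge m 4 with h4 | h4
  · have : chunks m ≤ 1 := by
      unfold chunks
      rw [e, Nat.ceil_le, Real.logb_le_iff_le_rpow (by norm_num) (by positivity), div_le_iff₀ hl0]
      norm_num
      have h8 : (2 : ℝ) ^ (m : ℝ) ≤ (m : ℝ) ^ (2 : ℝ) := by
        interval_cases m <;> norm_num
      have h9 := Real.logb_le_logb_of_le (b := 2) (by norm_num) (by positivity) h8
      rw [Real.logb_rpow (by norm_num) (by norm_num), Real.logb_rpow_eq_mul_logb_of_pos hm] at h9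
      exact h9
    calc 2 ^ chunks m ≤ 2 ^ 1 := Nat.pow_le_pow_right (by norm_num) this
      _ ≤ m + 1 := by omega
  · have hl2 : 2 ≤ Real.logb 2 m := by
      rw [Real.le_logb_iff_rpow_le (by norm_num) hm]
      norm_num
      exact_mod_cast h4
    have hle : Real.logb 2 m ≤ m := by
      rw [Real.logb_le_iff_le_rpow (by norm_num) hm, Real.rpow_natCast]
      exact_mod_cast (Nat.lt_two_pow_self (n := m)).le
    have hpos : 0 ≤ Real.logb 2 (m / Real.logb 2 m) :=
      Real.logb_nonneg (by norm_num) ((one_le_div hl0).2 hle)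
    have hC : (chunks m : ℝ) ≤ Real.logb 2 (m / Real.logb 2 m) + 1 := by
      unfold chunks
      rw [e]
      exact (Nat.ceil_lt_add_one hpos).le
    have : (2 : ℝ) ^ (chunks m : ℝ) ≤ m := by
      calc (2 : ℝ) ^ (chunks m : ℝ) ≤ 2 ^ (Real.logb 2 (m / Real.logb 2 m) + 1) :=
            Real.rpow_le_rpow_of_exponent_le (by norm_num) hC
        _ = m / Real.logb 2 m * 2 := by
            rw [Real.rpow_add (by norm_num), Real.rpow_logb (by norm_num) (by norm_num)
              (by positivity), Real.rpow_one]
        _ ≤ m := by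
            rw [div_mul_eq_mul_div, div_le_iff₀ hl0]
            gcongr
    rw [Real.rpow_natCast] at this
    have h' : 2 ^ chunks m ≤ m := by exact_mod_cast this
    omega

/-- Chunks are counted from `0`.  The bin taken from chunk `i` has size `2 ^ i`, and its `j`-th ID
is produced after all the IDs of the bins of sizes `1, 2, …, 2 ^ (i - 1)`. -/
theorem time_lt {m : ℕ} (i : Fin (chunks m)) (j : Fin (2 ^ (i : ℕ))) :
    2 ^ (i : ℕ) - 1 + (j : ℕ) < m := by
  have h1 := two_pow_chunks_le m
  have h2 : 2 ^ ((i : ℕ) + 1) ≤ 2 ^ chunks m := Nat.pow_le_pow_right (by norm_num) i.isLt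
  have h3 := j.isLt
  have h4 : 0 < 2 ^ (i : ℕ) := by positivity
  rw [pow_succ] at h2
  omega

/-- `A` is (an implementation of) `BINS*`.  The chunks `0, …, C - 1` are consecutive blocks of
`2 ^ (C - 1)` IDs, and chunk `i` consists of `2 ^ (C - 1 - i)` consecutive bins of size `2 ^ i`.
For each `i` in turn, the bin with a uniformly random number `b i` (independent for different `i`)
of chunk `i` is returned in increasing order.  What happens after the bin from the last chunk has
been exhausted, that is, after `2 ^ C - 1` IDs, is not specified by `BINS*`. -/
def IsBinsStar {m : ℕ} (A : Algorithm m) : Prop :=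
  A.map (fun σ (i : Fin (chunks m)) (j : Fin (2 ^ (i : ℕ))) =>
      (σ ⟨2 ^ (i : ℕ) - 1 + (j : ℕ), time_lt i j⟩ : ℕ)) =
    (PMF.uniformOfFintype ((i : Fin (chunks m)) → Fin (2 ^ (chunks m - 1 - (i : ℕ))))).map
      (fun b (i : Fin (chunks m)) (j : Fin (2 ^ (i : ℕ))) =>
        (i : ℕ) * 2 ^ (chunks m - 1) + (b i : ℕ) * 2 ^ (i : ℕ) + (j : ℕ))

end UUID

end

noncomputable section

namespace UUID

open Finset
open scoped Classical

variable {m n : ℕ}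

/-! ### Histories -/

/-! The adversary learns nothing useful before the first collision. Fix a profile `D` and an
instance `j` that is to return one more ID. For these algorithms, the conditional probability `h`
that this ID causes a collision is the same for every collision-free history of `D`
(`exists_hazard`). Inside a bin it is 0: a collision there repeats an earlier one. At the start of a
bin, the new ID is uniform on the unused elements of a fixed set, and the profile alone fixes how
many of these there are and how many belong to other instances. `HazardRegular` isolates this
property; `hazardRegular_bins` and `IsBinsStar.hazardRegular` verify it.

Write `p` for the collision probability of the current profile and `p'` for that of the next one.
Averaging over histories gives `p' = p + h * (1 - p)` (`collisionProb_update`). Adaptivity therefore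
matters only through what happens after a collision, and there `p` can never decrease again. The
potential argument (`request_inequality`, `play_inequality`) proves by induction on the strategy
that a collision-free history of probability `W` satisfies P(history, later collision) + `W * p` ≤ 2
· E[final `p`; history]. All terms are unnormalized weights, so no conditioning on null events
occurs. At the empty history this bounds the adaptive collision probability by twice the expected
`p` of the final profile. Comparing `p` with `p_*` profile by profile then yields the ratio `2 * c`,
which is stronger than `4 * c`. -/

/-- The first `D i` IDs of each instance `i` are the ones recorded in `ρ`. -/
def Agrees (D : Fin n → ℕ) (ρ : Fin n → Fin m → Fin m) (σ : Fin n → Equiv.Perm (Fin m)) : Prop :=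
  ∀ i (a : Fin m), (a : ℕ) < D i → σ i a = ρ i a

/-- The recorded IDs are not pairwise disjoint. -/
def HistCollision (ρ : Fin n → Fin m → Fin m) (D : Fin n → ℕ) : Prop :=
  ∃ i j : Fin n, i ≠ j ∧ ∃ a b : Fin m, (a : ℕ) < D i ∧ (b : ℕ) < D j ∧ ρ i a = ρ j b

/-- The probability of the orders `σ`, cut off to those that agree with the history `ρ`. -/
def histWeight (A : Algorithm m) (D : Fin n → ℕ) (ρ : Fin n → Fin m → Fin m)
    (σ : Fin n → Equiv.Perm (Fin m)) : ℝ≥0∞ :=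
  if Agrees D ρ σ then ∏ i, A (σ i) else 0

theorem Agrees.collision_iff {D : Fin n → ℕ} {ρ : Fin n → Fin m → Fin m}
    {σ : Fin n → Equiv.Perm (Fin m)} (h : Agrees D ρ σ) :
    Collision σ D ↔ HistCollision ρ D := by
  constructor
  · rintro ⟨i, j, hij, a, b, ha, hb, e⟩
    exact ⟨i, j, hij, a, b, ha, hb, by rw [← h i a ha, ← h j b hb, e]⟩
  · rintro ⟨i, j, hij, a, b, ha, hb, e⟩
    exact ⟨i, j, hij, a, b, ha, hb, by rw [h i a ha, h j b hb, e]⟩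

theorem histWeight_ne_zero {A : Algorithm m} {D : Fin n → ℕ} {ρ : Fin n → Fin m → Fin m}
    {σ : Fin n → Equiv.Perm (Fin m)} (h : histWeight A D ρ σ ≠ 0) :
    Agrees D ρ σ ∧ ∀ i, σ i ∈ A.support := by
  unfold histWeight at h
  split_ifs at h with h1
  · refine ⟨h1, fun i => ?_⟩
    rw [PMF.mem_support_iff]
    exact Finset.prod_ne_zero_iff.1 h i (mem_univ i)
  · exact absurd rfl h

theorem sum_pmf (A : Algorithm m) : ∑ τ, A τ = 1 := by
  rw [← tsum_fintype (L := .unconditional _)]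
  exact A.tsum_coe

theorem sum_prod_pmf (A : Algorithm m) :
    ∑ σ : Fin n → Equiv.Perm (Fin m), ∏ i, A (σ i) = 1 := by
  have h := Finset.prod_univ_sum (ι := Fin n)
    (fun _ => (univ : Finset (Equiv.Perm (Fin m)))) (fun _ τ => A τ)
  rw [Fintype.piFinset_univ] at h
  rw [← h]
  simp [sum_pmf]

theorem sum_histWeight_le_one (A : Algorithm m) (D : Fin n → ℕ) (ρ : Fin n → Fin m → Fin m) :
    ∑ σ, histWeight A D ρ σ ≤ 1 := by
  rw [← sum_prod_pmf (n := n) A]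
  refine Finset.sum_le_sum fun σ _ => ?_
  unfold histWeight
  split_ifs <;> simp

/-- Extending a history by one more ID `x`, the one with index `t` of instance `j`. -/
def extend (ρ : Fin n → Fin m → Fin m) (j : Fin n) (t x : Fin m) : Fin n → Fin m → Fin m :=
  Function.update ρ j (Function.update (ρ j) t x)

theorem agrees_extend_iff {D : Fin n → ℕ} {ρ : Fin n → Fin m → Fin m} {j : Fin n}
    (hj : D j < m) {x : Fin m} {σ : Fin n → Equiv.Perm (Fin m)} :
    Agrees (Function.update D j (D j + 1)) (extend ρ j ⟨D j, hj⟩ x) σ ↔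
      Agrees D ρ σ ∧ σ j ⟨D j, hj⟩ = x := by
  constructor
  · intro h
    refine ⟨fun i a ha => ?_, ?_⟩
    · by_cases hi : i = j
      · subst hi
        have hne : a ≠ ⟨D i, hj⟩ := by
          rintro rfl
          exact lt_irrefl _ ha
        have := h i a (by simp; omega)
        simpa [extend, Function.update_of_ne hne] using this
      · have := h i a (by rwa [Function.update_of_ne hi])
        simpa [extend, Function.update_of_ne hi] using this
    · have := h j ⟨D j, hj⟩ (by simp)
      simpa [extend] using this
  · rintro ⟨h, hx⟩ i a ha
    by_cases hi : i = j
    · subst hi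
      simp only [Function.update_self] at ha
      by_cases hne : a = ⟨D i, hj⟩
      · subst hne
        simpa [extend] using hx
      · have : (a : ℕ) < D i := by
          have : (a : ℕ) ≠ D i := fun e => hne (Fin.ext e)
          omega
        simpa [extend, Function.update_of_ne hne] using h i a this
    · rw [Function.update_of_ne hi] at ha
      simpa [extend, Function.update_of_ne hi] using h i a ha

theorem histWeight_extend (A : Algorithm m) {D : Fin n → ℕ} (ρ : Fin n → Fin m → Fin m) {j : Fin n}
    (hj : D j < m) (x : Fin m) (σ : Fin n → Equiv.Perm (Fin m)) :
    histWeight A (Function.update D j (D j + 1)) (extend ρ j ⟨D j, hj⟩ x) σ =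
      if σ j ⟨D j, hj⟩ = x then histWeight A D ρ σ else 0 := by
  unfold histWeight
  simp only [agrees_extend_iff]
  split_ifs <;> simp_all

/-- Summing over the next ID. -/
theorem sum_histWeight_mul (A : Algorithm m) {D : Fin n → ℕ} (ρ : Fin n → Fin m → Fin m) {j : Fin n}
    (hj : D j < m) (X : Fin m → (Fin n → Equiv.Perm (Fin m)) → ℝ≥0∞) :
    ∑ σ, histWeight A D ρ σ * X (σ j ⟨D j, hj⟩) σ =
      ∑ x, ∑ σ, histWeight A (Function.update D j (D j + 1)) (extend ρ j ⟨D j, hj⟩ x) σ * X x σ := by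
  rw [Finset.sum_comm]
  refine Finset.sum_congr rfl fun σ _ => ?_
  simp [histWeight_extend]

/-! ### Monotonicity of the collision probability -/

theorem Collision.mono {σ : Fin n → Equiv.Perm (Fin m)} {D D' : Fin n → ℕ} (h : Collision σ D)
    (hD : ∀ i, D i ≤ D' i) : Collision σ D' := by
  obtain ⟨i, j, hij, a, b, ha, hb, e⟩ := h
  exact ⟨i, j, hij, a, b, ha.trans_le (hD i), hb.trans_le (hD j), e⟩

theorem collisionProb_mono (A : Algorithm m) {D D' : Fin n → ℕ} (hD : ∀ i, D i ≤ D' i) :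
    collisionProb A ⟨n, D⟩ ≤ collisionProb A ⟨n, D'⟩ := by
  refine Finset.sum_le_sum fun σ _ => ?_
  by_cases h : Collision σ D
  · have h' := h.mono hD
    simp [h, h']
  · simp [h]

theorem collision_snoc_zero_iff {σ : Fin n → Equiv.Perm (Fin m)} {τ : Equiv.Perm (Fin m)}
    {D : Fin n → ℕ} :
    Collision (Fin.snoc (α := fun _ => Equiv.Perm (Fin m)) σ τ)
      (Fin.snoc (α := fun _ => ℕ) D 0) ↔ Collision σ D := by
  constructor
  · rintro ⟨i, j, hij, a, b, ha, hb, e⟩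
    induction i using Fin.lastCases with
    | last => simp at ha
    | cast i =>
      induction j using Fin.lastCases with
      | last => simp at hb
      | cast j =>
        simp only [Fin.snoc_castSucc] at ha hb e
        exact ⟨i, j, fun h => hij (by rw [h]), a, b, ha, hb, e⟩
  · rintro ⟨i, j, hij, a, b, ha, hb, e⟩
    exact ⟨i.castSucc, j.castSucc, fun h => hij (Fin.castSucc_injective _ h), a, b,
      by simpa using ha, by simpa using hb, by simpa using e⟩

theorem sum_snoc {α M : Type*} [Fintype α] [AddCommMonoid M] (f : (Fin (n + 1) → α) → M) :
    ∑ σ, f σ = ∑ σ : Fin n → α, ∑ τ, f (Fin.snoc (α := fun _ => α) σ τ) := by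
  rw [← Equiv.sum_comp (Fin.snocEquiv (fun _ => α)), Fintype.sum_prod_type, Finset.sum_comm]
  rfl

theorem collisionProb_snoc_zero (A : Algorithm m) (D : Fin n → ℕ) :
    collisionProb A ⟨n + 1, Fin.snoc (α := fun _ => ℕ) D 0⟩ = collisionProb A ⟨n, D⟩ := by
  unfold collisionProb
  simp only
  rw [sum_snoc]
  refine Finset.sum_congr rfl fun σ _ => ?_
  simp only [collision_snoc_zero_iff, Fin.prod_univ_castSucc, Fin.snoc_castSucc, Fin.snoc_last]
  split_ifs
  · rw [← Finset.mul_sum, sum_pmf, mul_one]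
  · simp

/-- The probability that there is no collision. -/
def noCollisionProb (A : Algorithm m) (D : Fin n → ℕ) : ℝ≥0∞ :=
  ∑ σ : Fin n → Equiv.Perm (Fin m), if Collision σ D then 0 else ∏ i, A (σ i)

theorem collisionProb_add_noCollisionProb (A : Algorithm m) (D : Fin n → ℕ) :
    collisionProb A ⟨n, D⟩ + noCollisionProb A D = 1 := by
  rw [← sum_prod_pmf (n := n) A, collisionProb, noCollisionProb, ← Finset.sum_add_distrib]
  refine Finset.sum_congr rfl fun σ _ => ?_
  simp only
  split_ifs <;> simp

/-! ### The hazard of a request -/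

/-- Up to time `M`, an ID of `A` can collide only in one way.  At a time `t` of the first kind, it
collides only with instances with which there has been a collision already.  At a time `t` of the
second kind, the ID is, given the previous ones, uniformly distributed among the unused elements of
a set `G`, whose elements are returned at the times in a fixed set `T`. -/
def HazardRegular (A : Algorithm m) (M : ℕ) : Prop :=
  ∀ t : Fin m, (t : ℕ) < M →
    (∀ σ ∈ A.support, ∀ τ ∈ A.support, ∀ b : Fin m, (b : ℕ) < M → τ b = σ t →
      ∃ a < t, ∃ b' ≤ b, σ a = τ b') ∨
    ∃ G T : Finset (Fin m), t ∈ T ∧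
      (∀ σ ∈ A.support, ∀ a : Fin m, (a : ℕ) < M → (σ a ∈ G ↔ a ∈ T)) ∧
      ∀ ρ : Fin m → Fin m, ∃ u : ℝ≥0∞, ∀ x ∈ G, (∀ a < t, ρ a ≠ x) →
        (∑ τ, if (∀ a < t, τ a = ρ a) ∧ τ t = x then A τ else 0) = u

theorem sum_ite_forall_prod (A : Algorithm m) (P : Fin n → Equiv.Perm (Fin m) → Prop)
    [∀ i, DecidablePred (P i)]
    [DecidablePred fun σ : Fin n → Equiv.Perm (Fin m) => ∀ i, P i (σ i)] :
    (∑ σ : Fin n → Equiv.Perm (Fin m), if ∀ i, P i (σ i) then ∏ i, A (σ i) else 0) =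
      ∏ i, ∑ τ, if P i τ then A τ else 0 := by
  rw [Finset.prod_univ_sum, Fintype.piFinset_univ]
  refine Finset.sum_congr rfl fun σ _ => ?_
  split_ifs with h
  · exact Finset.prod_congr rfl fun i _ => by simp [h i]
  · obtain ⟨i, hi⟩ := not_forall.1 h
    exact (Finset.prod_eq_zero (mem_univ i) (by simp [hi])).symm

/-- A collision that occurs when instance `j` returns one more ID involves this ID. -/
theorem collision_update {σ : Fin n → Equiv.Perm (Fin m)} {D : Fin n → ℕ} {j : Fin n}
    (hj : D j < m) (h : ¬ Collision σ D)
    (h' : Collision σ (Function.update D j (D j + 1))) :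
    ∃ i, i ≠ j ∧ ∃ b : Fin m, (b : ℕ) < D i ∧ σ i b = σ j ⟨D j, hj⟩ := by
  have key : ∀ i ≠ j, ∀ a b : Fin m, (a : ℕ) < D i → (b : ℕ) < D j + 1 → σ i a = σ j b →
      ∃ i, i ≠ j ∧ ∃ b : Fin m, (b : ℕ) < D i ∧ σ i b = σ j ⟨D j, hj⟩ := by
    intro i hi a b ha hb e
    by_cases hb' : (b : ℕ) = D j
    · have : b = ⟨D j, hj⟩ := Fin.ext hb'
      exact ⟨i, hi, a, ha, by rw [e, this]⟩
    · exact absurd ⟨i, j, hi, a, b, ha, by omega, e⟩ h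
  obtain ⟨i, i', hii, a, b, ha, hb, e⟩ := h'
  by_cases h1 : i = j
  · subst h1
    rw [Function.update_of_ne hii.symm] at hb
    rw [Function.update_self] at ha
    exact key i' hii.symm b a hb ha e.symm
  · rw [Function.update_of_ne h1] at ha
    by_cases h2 : i' = j
    · subst h2
      rw [Function.update_self] at hb
      exact key i h1 a b ha hb e
    · rw [Function.update_of_ne h2] at hb
      exact absurd ⟨i, i', hii, a, b, ha, hb, e⟩ h

/-- A collision caused by the new ID would, by `hf`, come with a collision between strictly earlier
IDs of `j` and IDs already returned by the other instance. The history excludes this. -/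
theorem hazard_forced {A : Algorithm m} {M : ℕ} {D : Fin n → ℕ} {j : Fin n} (hj : D j < m)
    (hM : ∀ i, D i ≤ M)
    (hf : ∀ σ ∈ A.support, ∀ τ ∈ A.support, ∀ b : Fin m, (b : ℕ) < M → τ b = σ ⟨D j, hj⟩ →
      ∃ a < (⟨D j, hj⟩ : Fin m), ∃ b' ≤ b, σ a = τ b')
    {ρ : Fin n → Fin m → Fin m} (hρ : ¬ HistCollision ρ D) :
    (∑ σ, if Collision σ (Function.update D j (D j + 1)) then histWeight A D ρ σ else 0) = 0 := by
  refine Finset.sum_eq_zero fun σ _ => ?_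
  split_ifs with hc
  · by_contra h0
    obtain ⟨hag, hs⟩ := histWeight_ne_zero h0
    have hnc : ¬ Collision σ D := by rwa [hag.collision_iff]
    obtain ⟨i, hi, b, hb, e⟩ := collision_update hj hnc hc
    obtain ⟨a, ha, b', hb', e'⟩ := hf _ (hs j) _ (hs i) b (hb.trans_le (hM i)) e
    exact hnc ⟨j, i, hi.symm, a, b', ha, lt_of_le_of_lt (Fin.le_def.1 hb') hb, e'⟩
  · rfl

/-- The IDs recorded for the instances other than `j`. -/
def othersIDs (ρ : Fin n → Fin m → Fin m) (D : Fin n → ℕ) (j : Fin n) : Finset (Fin m) :=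
  (univ.erase j).biUnion fun i => (univ.filter fun a : Fin m => (a : ℕ) < D i).image (ρ i)

/-- How many recorded IDs of an instance lie in `G` is read off from its demand, since `G` is
visited exactly at the times in `T`. -/
theorem card_image_inter {σ : Equiv.Perm (Fin m)} {ρ : Fin m → Fin m} {d M : ℕ}
    {G T : Finset (Fin m)} (hd : d ≤ M) (h : ∀ a : Fin m, (a : ℕ) < d → σ a = ρ a)
    (hG : ∀ a : Fin m, (a : ℕ) < M → (σ a ∈ G ↔ a ∈ T)) :
    #((univ.filter fun a : Fin m => (a : ℕ) < d).image ρ ∩ G) =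
      #(T.filter fun a : Fin m => (a : ℕ) < d) := by
  have : (univ.filter fun a : Fin m => (a : ℕ) < d).image ρ ∩ G =
      (T.filter fun a : Fin m => (a : ℕ) < d).image σ := by
    ext x
    simp only [mem_inter, mem_image, mem_filter, mem_univ, true_and]
    constructor
    · rintro ⟨⟨a, ha, rfl⟩, hx⟩
      rw [← h a ha] at hx
      exact ⟨a, ⟨(hG a (ha.trans_le hd)).1 hx, ha⟩, h a ha⟩
    · rintro ⟨a, ⟨haT, ha⟩, rfl⟩
      exact ⟨⟨a, ha, (h a ha).symm⟩, (hG a (ha.trans_le hd)).2 haT⟩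
  rw [this, card_image_of_injective _ σ.injective]

theorem exists_of_sum_ite_ne_zero {A : Algorithm m} {P : Equiv.Perm (Fin m) → Prop}
    [DecidablePred P]
    (h : (∑ τ, if P τ then A τ else 0) ≠ 0) : ∃ τ ∈ A.support, P τ := by
  obtain ⟨τ, -, hτ⟩ := Finset.exists_ne_zero_of_sum_ne_zero h
  split_ifs at hτ with hP
  · exact ⟨τ, (PMF.mem_support_iff _ _).2 hτ, hP⟩
  · exact absurd rfl hτ

/-- For a set `Y` of IDs, the probability that an instance with the history `r` returns an element
of `Y` next. -/
theorem sum_ite_mem_eq {A : Algorithm m} {M : ℕ} {t : Fin m} (ht : (t : ℕ) < M)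
    {G T : Finset (Fin m)} (htT : t ∈ T)
    (hG : ∀ σ ∈ A.support, ∀ a : Fin m, (a : ℕ) < M → (σ a ∈ G ↔ a ∈ T))
    {r : Fin m → Fin m} {u : ℝ≥0∞} (hu : ∀ x ∈ G, (∀ a < t, r a ≠ x) →
        (∑ τ, if (∀ a < t, τ a = r a) ∧ τ t = x then A τ else 0) = u) (Y : Finset (Fin m)) :
    (∑ τ, if (∀ a < t, τ a = r a) ∧ τ t ∈ Y then A τ else 0) =
      #((Y ∩ G) \ (univ.filter fun a : Fin m => a < t).image r) * u := by
  have h1 : (∑ τ, if (∀ a < t, τ a = r a) ∧ τ t ∈ Y then A τ else 0) =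
      ∑ x ∈ Y, ∑ τ, if (∀ a < t, τ a = r a) ∧ τ t = x then A τ else 0 := by
    rw [Finset.sum_comm]
    refine Finset.sum_congr rfl fun τ _ => ?_
    by_cases h : ∀ a < t, τ a = r a
    · simp only [and_iff_right h]
      rw [Finset.sum_ite_eq]
    · simp only [h, false_and, if_false, Finset.sum_const_zero]
  rw [h1, ← nsmul_eq_mul, ← Finset.sum_const]
  rw [← Finset.sum_subset (s₁ := (Y ∩ G) \ (univ.filter fun a : Fin m => a < t).image r)]
  · refine Finset.sum_congr rfl fun x hx => ?_
    simp only [mem_sdiff, mem_inter, mem_image, mem_filter, mem_univ, true_and, not_exists,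
      not_and] at hx
    exact hu x hx.1.2 fun a ha => hx.2 a ha
  · exact sdiff_subset.trans inter_subset_left
  · intro x hxY hx
    by_contra h0
    obtain ⟨τ, hτ, hp, hx'⟩ := exists_of_sum_ite_ne_zero h0
    apply hx
    simp only [mem_sdiff, mem_inter, mem_image, mem_filter, mem_univ, true_and, not_exists,
      not_and]
    refine ⟨⟨hxY, hx' ▸ (hG τ hτ t ht).2 htT⟩, fun a ha e => ?_⟩
    rw [← hp a ha, ← hx'] at e
    exact ha.ne (τ.injective e)

/-- Without a collision the recorded sets are disjoint, so their contributions to `G` add up to a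
number that depends on `D` only. The assumption `hpos` provides an actual order behind each record.
-/
theorem card_othersIDs_inter {D : Fin n → ℕ} {j : Fin n} {M : ℕ} (hM : ∀ i, D i ≤ M)
    {A : Algorithm m} {G T : Finset (Fin m)}
    (hG : ∀ σ ∈ A.support, ∀ a : Fin m, (a : ℕ) < M → (σ a ∈ G ↔ a ∈ T))
    {ρ : Fin n → Fin m → Fin m} (hρ : ¬ HistCollision ρ D)
    (hpos : ∀ i ≠ j, ∃ τ ∈ A.support, ∀ a : Fin m, (a : ℕ) < D i → τ a = ρ i a) :
    #(othersIDs ρ D j ∩ G) =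
      ∑ i ∈ univ.erase j, #(T.filter fun a : Fin m => (a : ℕ) < D i) := by
  rw [othersIDs, Finset.biUnion_inter, Finset.card_biUnion]
  · refine Finset.sum_congr rfl fun i hi => ?_
    obtain ⟨τ, hτ, h⟩ := hpos i (ne_of_mem_erase hi)
    exact card_image_inter (hM i) h (hG τ hτ)
  · intro i _ i' _ hii
    refine Finset.disjoint_left.2 fun x hx hx' => ?_
    simp only [mem_inter, mem_image, mem_filter, mem_univ, true_and] at hx hx'
    obtain ⟨⟨a, ha, e⟩, -⟩ := hx
    obtain ⟨⟨b, hb, e'⟩, -⟩ := hx'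
    exact hρ ⟨i, i', hii, a, b, ha, hb, e.trans e'.symm⟩

theorem othersIDs_inter_sdiff {D : Fin n → ℕ} {j : Fin n} {t : Fin m} (ht : (t : ℕ) = D j)
    {ρ : Fin n → Fin m → Fin m} (hρ : ¬ HistCollision ρ D) (G : Finset (Fin m)) :
    (othersIDs ρ D j ∩ G) \ (univ.filter fun a : Fin m => a < t).image (ρ j) =
      othersIDs ρ D j ∩ G := by
  rw [Finset.sdiff_eq_self_iff_disjoint, Finset.disjoint_left]
  intro x hx hx'
  simp only [othersIDs, mem_inter, mem_image, mem_filter, mem_univ, true_and, mem_biUnion,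
    mem_erase, and_true] at hx hx'
  obtain ⟨⟨i, hi, a, ha, e⟩, -⟩ := hx
  obtain ⟨b, hb, e'⟩ := hx'
  exact hρ ⟨i, j, hi, a, b, ha, by rw [← ht]; exact hb, e.trans e'.symm⟩

/-- The hazard is (elements of `G` held by other instances) / (elements of `G` not yet used by `j`).
Independence makes the weight of a history a product over instances. The factors other than `j` are
common to both sides, and the factor of `j` is a count times the common value `u`, which cancels. -/
theorem hazard_free {A : Algorithm m} {M : ℕ} {D : Fin n → ℕ} {j : Fin n} (hj : D j < m)
    (hM : ∀ i, D i ≤ M) (hjM : D j < M) {G T : Finset (Fin m)} (htT : ⟨D j, hj⟩ ∈ T)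
    (hG : ∀ σ ∈ A.support, ∀ a : Fin m, (a : ℕ) < M → (σ a ∈ G ↔ a ∈ T))
    (hu : ∀ ρ : Fin m → Fin m, ∃ u : ℝ≥0∞, ∀ x ∈ G, (∀ a < (⟨D j, hj⟩ : Fin m), ρ a ≠ x) →
        (∑ τ, if (∀ a < (⟨D j, hj⟩ : Fin m), τ a = ρ a) ∧ τ ⟨D j, hj⟩ = x then A τ else 0) = u)
    {ρ : Fin n → Fin m → Fin m} (hρ : ¬ HistCollision ρ D) :
    (∑ σ, if Collision σ (Function.update D j (D j + 1)) then histWeight A D ρ σ else 0) =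
      (((∑ i ∈ univ.erase j, #(T.filter fun a : Fin m => (a : ℕ) < D i) : ℕ) : ℝ≥0∞) /
        ((#G - #(T.filter fun a : Fin m => (a : ℕ) < D j) : ℕ) : ℝ≥0∞)) *
        ∑ σ, histWeight A D ρ σ := by
  set t : Fin m := ⟨D j, hj⟩ with ht
  set Y := othersIDs ρ D j with hY
  set F : Fin n → ℝ≥0∞ := fun i =>
    ∑ τ, if (∀ a : Fin m, (a : ℕ) < D i → τ a = ρ i a) then A τ else 0 with hF
  have hW : ∑ σ, histWeight A D ρ σ = F j * ∏ i ∈ univ.erase j, F i := by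
    rw [Finset.mul_prod_erase _ _ (mem_univ j)]
    refine Eq.trans (Finset.sum_congr rfl fun σ _ => ?_)
      (sum_ite_forall_prod A fun i τ => ∀ a : Fin m, (a : ℕ) < D i → τ a = ρ i a)
    unfold histWeight
    exact if_congr Iff.rfl rfl rfl
  set F' : ℝ≥0∞ := ∑ τ, if (∀ a < t, τ a = ρ j a) ∧ τ t ∈ Y then A τ else 0 with hF'
  have hK : (∑ σ, if Collision σ (Function.update D j (D j + 1)) then histWeight A D ρ σ else 0) =
      F' * ∏ i ∈ univ.erase j, F i := by
    -- The guard `i = j` imposes the collision condition on coordinate `j` alone, so that the event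
    -- stays a product of events for single instances.
    have e := sum_ite_forall_prod A fun i τ =>
      (∀ a : Fin m, (a : ℕ) < D i → τ a = ρ i a) ∧ (i = j → τ t ∈ Y)
    rw [← Finset.mul_prod_erase _ _ (mem_univ j)] at e
    have e1 : (∑ τ, if (∀ a : Fin m, (a : ℕ) < D j → τ a = ρ j a) ∧ (j = j → τ t ∈ Y)
        then A τ else 0) = F' := by
      simp only [hF', true_imp_iff, Fin.lt_def, ht]
    have e2 : (∏ i ∈ univ.erase j, ∑ τ, if (∀ a : Fin m, (a : ℕ) < D i → τ a = ρ i a) ∧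
        (i = j → τ t ∈ Y) then A τ else 0) = ∏ i ∈ univ.erase j, F i := by
      refine Finset.prod_congr rfl fun i hi => ?_
      have := ne_of_mem_erase hi
      simp [hF, this]
    rw [← e1, ← e2]
    refine Eq.trans ?_ e
    refine Finset.sum_congr rfl fun σ _ => ?_
    unfold histWeight
    rw [← ite_and]
    refine if_congr ?_ rfl rfl
    constructor
    · rintro ⟨hc, hag⟩ i
      refine ⟨hag i, ?_⟩
      rintro rfl
      obtain ⟨i', hi', b, hb, e⟩ := collision_update hj (by rwa [hag.collision_iff]) hc
      simp only [hY, othersIDs, mem_image, mem_filter, mem_univ, true_and, mem_biUnion,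
        mem_erase, and_true]
      exact ⟨i', hi', b, hb, by rw [← hag i' b hb, e]⟩
    · intro h
      have hag : Agrees D ρ σ := fun i => (h i).1
      refine ⟨?_, hag⟩
      have := (h j).2 rfl
      simp only [hY, othersIDs, mem_image, mem_filter, mem_univ, true_and, mem_biUnion,
        mem_erase, and_true] at this
      obtain ⟨i, hi, a, ha, e⟩ := this
      refine ⟨i, j, hi, a, t, ?_, ?_, ?_⟩
      · rwa [Function.update_of_ne hi]
      · simp [ht]
      · rw [hag i a ha, e]
  rw [hW, hK]
  by_cases hrest : ∏ i ∈ univ.erase j, F i = 0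
  · simp [hrest]
  rw [← mul_assoc]
  congr 1
  have hpos : ∀ i ≠ j, ∃ τ ∈ A.support, ∀ a : Fin m, (a : ℕ) < D i → τ a = ρ i a := fun i hi =>
    exists_of_sum_ite_ne_zero
      (Finset.prod_ne_zero_iff.1 hrest i (mem_erase.2 ⟨hi, mem_univ i⟩))
  obtain ⟨u, hu⟩ := hu (ρ j)
  have hFj : F j = #(G \ (univ.filter fun a : Fin m => a < t).image (ρ j)) * u := by
    have := sum_ite_mem_eq hjM htT hG hu univ
    rw [univ_inter] at this
    rw [← this]
    simp only [hF, mem_univ, and_true, Fin.lt_def, ht]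
  have hF'Y : F' = #(Y ∩ G) * u := by
    rw [hF', sum_ite_mem_eq hjM htT hG hu Y, hY,
      othersIDs_inter_sdiff (D := D) (j := j) (t := t) rfl hρ]
  rw [hF'Y, card_othersIDs_inter hM hG hρ hpos]
  -- If the record of `j` is impossible, both sides vanish. Otherwise an actual order realizes it,
  -- which gives the denominator; that is nonzero because `F j` is.
  by_cases h0 : F j = 0
  · rw [h0, mul_zero, ← card_othersIDs_inter hM hG hρ hpos, ← hF'Y, ← le_zero_iff, ← h0]
    refine Finset.sum_le_sum fun τ _ => ?_
    simp only [Fin.lt_def, ht]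
    split_ifs <;> simp_all
  obtain ⟨τ, hτ, hag⟩ := exists_of_sum_ite_ne_zero h0
  have hcard : #(G \ (univ.filter fun a : Fin m => a < t).image (ρ j)) =
      #G - #(T.filter fun a : Fin m => (a : ℕ) < D j) := by
    rw [Finset.card_sdiff, ← card_image_inter (hM j) hag (hG τ hτ)]
    rfl
  rw [hcard] at hFj
  rw [hFj, ← mul_assoc, ENNReal.div_mul_cancel _ (ENNReal.natCast_ne_top _)]
  intro hz
  exact h0 (by rw [hFj, hz, zero_mul])

theorem exists_hazard {A : Algorithm m} {M : ℕ} (hA : HazardRegular A M) {D : Fin n → ℕ}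
    {j : Fin n} (hj : D j < m) (hM : ∀ i, Function.update D j (D j + 1) i ≤ M) :
    ∃ h : ℝ≥0∞, ∀ ρ : Fin n → Fin m → Fin m, ¬ HistCollision ρ D →
      (∑ σ, if Collision σ (Function.update D j (D j + 1)) then histWeight A D ρ σ else 0) =
        h * ∑ σ, histWeight A D ρ σ := by
  have hjM : D j < M := by simpa using hM j
  have hDM : ∀ i, D i ≤ M := by
    intro i
    by_cases hi : i = j
    · subst hi; exact hjM.le
    · simpa [Function.update_of_ne hi] using hM i
  rcases hA ⟨D j, hj⟩ hjM with hf | ⟨G, T, htT, hG, hu⟩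
  · exact ⟨0, fun ρ hρ => by rw [hazard_forced hj hDM hf hρ, zero_mul]⟩
  · exact ⟨_, fun ρ hρ => hazard_free hj hDM hjM htT hG hu hρ⟩

/-- The hazard determines the increase of the collision probability. -/
theorem collisionProb_update {A : Algorithm m} {D : Fin n → ℕ} {j : Fin n} {h : ℝ≥0∞}
    (hh : ∀ ρ : Fin n → Fin m → Fin m, ¬ HistCollision ρ D →
      (∑ σ, if Collision σ (Function.update D j (D j + 1)) then histWeight A D ρ σ else 0) =
        h * ∑ σ, histWeight A D ρ σ) :
    collisionProb A ⟨n, Function.update D j (D j + 1)⟩ =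
      collisionProb A ⟨n, D⟩ + h * noCollisionProb A D := by
  set D' := Function.update D j (D j + 1) with hD'
  have hle : ∀ i, D i ≤ D' i := by
    intro i
    by_cases hi : i = j
    · subst hi; simp [hD']
    · simp [hD', Function.update_of_ne hi]
  have e1 : collisionProb A ⟨n, D'⟩ = collisionProb A ⟨n, D⟩ +
      ∑ σ : Fin n → Equiv.Perm (Fin m), if Collision σ D then 0 else
        if Collision σ D' then ∏ i, A (σ i) else 0 := by
    unfold collisionProb
    simp only
    rw [← Finset.sum_add_distrib]
    refine Finset.sum_congr rfl fun σ _ => ?_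
    by_cases hc : Collision σ D
    · simp [hc, hc.mono hle]
    · simp [hc]
  rw [e1]
  congr 1
  -- The fibres of `obs` are the histories of `D`: each is either entirely collided, contributing 0
  -- to both sides, or entirely collision-free, where the hazard applies.
  let obs : (Fin n → Equiv.Perm (Fin m)) → (Fin n → Fin m → Option (Fin m)) := fun σ i a =>
    if (a : ℕ) < D i then some (σ i a) else none
  have hobs : ∀ σ σ' : Fin n → Equiv.Perm (Fin m),
      obs σ = obs σ' ↔ Agrees D (fun i a => σ' i a) σ := by
    intro σ σ'
    constructor
    · intro h i a ha
      have := congrFun (congrFun h i) a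
      simpa [obs, ha] using this
    · intro h
      funext i a
      by_cases ha : (a : ℕ) < D i
      · simpa [obs, ha] using h i a ha
      · simp [obs, ha]
  unfold noCollisionProb
  rw [← Finset.sum_fiberwise univ obs, ← Finset.sum_fiberwise univ obs
    (fun σ => if Collision σ D then 0 else ∏ i, A (σ i)), Finset.mul_sum]
  refine Finset.sum_congr rfl fun o _ => ?_
  rcases (univ.filter fun σ => obs σ = o).eq_empty_or_nonempty with he | ⟨σ₀, hσ₀⟩
  · simp [he]
  have ho : obs σ₀ = o := by simpa using hσ₀
  subst ho
  by_cases hc : Collision σ₀ D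
  · have : ∀ σ ∈ univ.filter (fun σ => obs σ = obs σ₀), Collision σ D := by
      intro σ hσ
      have hag := (hobs σ σ₀).1 (by simpa using hσ)
      exact hag.collision_iff.2 hc
    rw [Finset.sum_eq_zero fun σ hσ => if_pos (this σ hσ),
      Finset.sum_eq_zero fun σ hσ => if_pos (this σ hσ), mul_zero]
  · have hn : ∀ σ ∈ univ.filter (fun σ => obs σ = obs σ₀), ¬ Collision σ D := by
      intro σ hσ
      have hag := (hobs σ σ₀).1 (by simpa using hσ)
      rw [hag.collision_iff]
      exact hc
    rw [Finset.sum_congr rfl fun σ hσ => if_neg (hn σ hσ),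
      Finset.sum_congr rfl fun σ hσ => if_neg (hn σ hσ)]
    have := hh (fun i a => σ₀ i a) hc
    simp only [histWeight, ← hobs] at this
    rw [Finset.sum_filter, Finset.sum_filter, ← this]
    refine Finset.sum_congr rfl fun σ _ => ?_
    split_ifs <;> rfl

/-! ### The potential argument -/

/-- One request: if the inequality holds after it for all non-collided histories, it holds
before. -/
theorem request_inequality {A : Algorithm m} {M : ℕ} (hA : HazardRegular A M) {D D' : Fin n → ℕ}
    {j : Fin n} (hj : D j < m) (hD' : D' = Function.update D j (D j + 1))
    {ρ : Fin n → Fin m → Fin m} (hρ : ¬ HistCollision ρ D)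
    (hM : ∀ σ, histWeight A D ρ σ ≠ 0 → ∀ i, D' i ≤ M)
    (X E : Fin m → (Fin n → Equiv.Perm (Fin m)) → ℝ≥0∞)
    (hX : ∀ x σ, X x σ ≤ 1) (hE : ∀ x σ, collisionProb A ⟨n, D'⟩ ≤ E x σ)
    (ih : ∀ x, ¬ HistCollision (extend ρ j ⟨D j, hj⟩ x) D' →
      (∑ σ, histWeight A D' (extend ρ j ⟨D j, hj⟩ x) σ * X x σ) +
        (∑ σ, histWeight A D' (extend ρ j ⟨D j, hj⟩ x) σ) * collisionProb A ⟨n, D'⟩ ≤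
      2 * ∑ σ, histWeight A D' (extend ρ j ⟨D j, hj⟩ x) σ * E x σ) :
    (∑ σ, histWeight A D ρ σ * X (σ j ⟨D j, hj⟩) σ) +
        (∑ σ, histWeight A D ρ σ) * collisionProb A ⟨n, D⟩ ≤
      2 * ∑ σ, histWeight A D ρ σ * E (σ j ⟨D j, hj⟩) σ := by
  subst hD'
  set D' := Function.update D j (D j + 1) with hD'
  by_cases h0 : ∀ σ, histWeight A D ρ σ = 0
  · simp [h0]
  -- One order of positive weight is needed: the bound by `M` is known only for histories that can
  -- occur.
  push Not at h0
  obtain ⟨σ₀, hσ₀⟩ := h0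
  obtain ⟨h, hh⟩ := exists_hazard hA hj (hM σ₀ hσ₀)
  have hp := collisionProb_update hh
  have hq := collisionProb_add_noCollisionProb A D
  set p := collisionProb A ⟨n, D⟩
  set p' := collisionProb A ⟨n, D'⟩
  set q := noCollisionProb A D
  set W := ∑ σ, histWeight A D ρ σ with hW
  set w : Fin m → ℝ≥0∞ := fun x => ∑ σ, histWeight A D' (extend ρ j ⟨D j, hj⟩ x) σ with hw
  set P : Fin m → Prop := fun x => HistCollision (extend ρ j ⟨D j, hj⟩ x) D' with hP
  have hWw : W = ∑ x, w x := by
    have := sum_histWeight_mul A ρ hj (fun _ _ => 1)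
    simpa using this
  set K := ∑ x, if P x then w x else 0 with hKdef
  have hK : K = h * W := by
    rw [← hh ρ hρ]
    have := sum_histWeight_mul A ρ hj (fun _ σ => if Collision σ D' then 1 else 0)
    simp only [mul_ite, mul_one, mul_zero] at this
    rw [this, hKdef]
    refine Finset.sum_congr rfl fun x _ => ?_
    have hcol : ∀ σ, histWeight A D' (extend ρ j ⟨D j, hj⟩ x) σ ≠ 0 → (Collision σ D' ↔ P x) :=
      fun σ hσ => (histWeight_ne_zero hσ).1.collision_iff
    by_cases hPx : P x
    · rw [if_pos hPx]
      refine Finset.sum_congr rfl fun σ _ => ?_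
      by_cases hσ : histWeight A D' (extend ρ j ⟨D j, hj⟩ x) σ = 0
      · rw [hσ, ite_self]
      · rw [if_pos ((hcol σ hσ).2 hPx)]
    · rw [if_neg hPx]
      symm
      refine Finset.sum_eq_zero fun σ _ => ?_
      by_cases hσ : histWeight A D' (extend ρ j ⟨D j, hj⟩ x) σ = 0
      · rw [hσ, ite_self]
      · rw [if_neg fun hc => hPx ((hcol σ hσ).1 hc)]
  have hWfin : W ≠ ⊤ := ne_top_of_le_ne_top ENNReal.one_ne_top (sum_histWeight_le_one A D ρ)
  have hKle : K ≤ W := by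
    rw [hWw]
    refine Finset.sum_le_sum fun x _ => ?_
    split_ifs <;> simp
  have hKfin : K ≠ ⊤ := ne_top_of_le_ne_top hWfin hKle
  -- For a collision-free continuation this is the induction hypothesis. For a collided one, the
  -- left side is at most `w x + 2 * w x * p'`, and the expected final collision probability is at
  -- least `p'`. The second copy of `w x * p'` is what uses up the factor 2.
  have step : ∀ x, (∑ σ, histWeight A D' (extend ρ j ⟨D j, hj⟩ x) σ * X x σ) + w x * p' +
      (if P x then w x else 0) * p' ≤
      2 * (∑ σ, histWeight A D' (extend ρ j ⟨D j, hj⟩ x) σ * E x σ) +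
        (if P x then w x else 0) := by
    intro x
    by_cases hPx : P x
    · simp only [if_pos hPx]
      have h1 : (∑ σ, histWeight A D' (extend ρ j ⟨D j, hj⟩ x) σ * X x σ) ≤ w x :=
        Finset.sum_le_sum fun σ _ => by
          simpa using mul_le_mul_right (hX x σ) (histWeight A D' (extend ρ j ⟨D j, hj⟩ x) σ)
      have h2 : w x * p' ≤ ∑ σ, histWeight A D' (extend ρ j ⟨D j, hj⟩ x) σ * E x σ := by
        rw [hw, Finset.sum_mul]
        exact Finset.sum_le_sum fun σ _ => by gcongr; exact hE x σ
      calc _ ≤ w x + (∑ σ, histWeight A D' (extend ρ j ⟨D j, hj⟩ x) σ * E x σ) +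
            (∑ σ, histWeight A D' (extend ρ j ⟨D j, hj⟩ x) σ * E x σ) := by gcongr
        _ = _ := by ring
    · simpa only [if_neg hPx, zero_mul, add_zero] using ih x hPx
  have total := Finset.sum_le_sum fun x (_ : x ∈ (univ : Finset (Fin m))) => step x
  simp only [Finset.sum_add_distrib, ← Finset.sum_mul, ← Finset.mul_sum] at total
  rw [← sum_histWeight_mul A ρ hj X, ← sum_histWeight_mul A ρ hj E, ← hWw, ← hKdef] at total
  -- The amount `K` paid for collided continuations is recovered from the growth of the potential:
  -- `W * p' = W * p + K * q`, while `K * p' ≥ K * p` and `p + q = 1`.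
  have gain : K + W * p ≤ W * p' + K * p' := by
    rw [hp, hK]
    calc h * W + W * p = h * W * (p + q) + W * p := by rw [hq, mul_one]
      _ ≤ h * W * (p + q) + W * p + h * W * (h * q) := le_self_add
      _ = _ := by ring
  refine (ENNReal.add_le_add_iff_right hKfin).1 ?_
  calc _ = (∑ σ, histWeight A D ρ σ * X (σ j ⟨D j, hj⟩) σ) + (K + W * p) := by ring
    _ ≤ (∑ σ, histWeight A D ρ σ * X (σ j ⟨D j, hj⟩) σ) + (W * p' + K * p') := by gcongr
    _ ≤ _ := by rw [← add_assoc]; exact total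

/-! ### Expectations along the game and the induction on strategies -/

/-- The expectation of `f` under `μ`. -/
def expect {α : Type*} (μ : PMF α) (f : α → ℝ≥0∞) : ℝ≥0∞ := ∑' a, μ a * f a

theorem expect_pure {α : Type*} (a : α) (f : α → ℝ≥0∞) : expect (PMF.pure a) f = f a := by
  unfold expect
  rw [tsum_eq_single a]
  · simp
  · intro b hb
    simp [hb]

theorem expect_bind {α β : Type*} (μ : PMF α) (κ : α → PMF β) (f : β → ℝ≥0∞) :
    expect (μ.bind κ) f = ∑' a, μ a * expect (κ a) f := by
  unfold expect
  simp only [PMF.bind_apply, ← ENNReal.tsum_mul_right, ← ENNReal.tsum_mul_left]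
  rw [ENNReal.tsum_comm]
  simp only [mul_assoc]

theorem expect_le_one {α : Type*} (μ : PMF α) {f : α → ℝ≥0∞} (hf : ∀ a, f a ≤ 1) :
    expect μ f ≤ 1 := by
  rw [← μ.tsum_coe]
  exact ENNReal.tsum_le_tsum fun a => by simpa using mul_le_mul_right (hf a) (μ a)

theorem le_tsum_pmf_mul {α : Type*} (μ : PMF α) {f : α → ℝ≥0∞} {c : ℝ≥0∞} (hf : ∀ a, c ≤ f a) :
    c ≤ ∑' a, μ a * f a := by
  calc c = ∑' a, μ a * c := by rw [ENNReal.tsum_mul_right, μ.tsum_coe, one_mul]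
    _ ≤ _ := ENNReal.tsum_le_tsum fun a => by gcongr; exact hf a

/-- Activation is a request to an instance with demand 0. Such an instance changes neither
collisions nor weights, so activations need no separate hazard analysis. -/
theorem snoc_one_eq (D : Fin n → ℕ) :
    (Fin.snoc (α := fun _ => ℕ) D 1 : Fin (n + 1) → ℕ) =
      Function.update (Fin.snoc (α := fun _ => ℕ) D 0) (Fin.last n)
        ((Fin.snoc (α := fun _ => ℕ) D 0 : Fin (n + 1) → ℕ) (Fin.last n) + 1) := by
  rw [Fin.snoc_last, Fin.update_snoc_last]

theorem le_update_succ (D : Fin n → ℕ) (j : Fin n) (i : Fin n) :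
    D i ≤ Function.update D j (D j + 1) i := by
  by_cases hi : i = j
  · subst hi; simp
  · simp [Function.update_of_ne hi]

/-- In the course of the game, the collision probability of the profile does not decrease. -/
theorem collisionProb_le_expect_play (A : Algorithm m) {D : Fin n → ℕ} (Z : Adversary m D)
    (σ : Fin n → Equiv.Perm (Fin m)) :
    collisionProb A ⟨n, D⟩ ≤ expect (Z.play A σ) fun o => collisionProb A o.profile := by
  induction Z with
  | halt => rw [Adversary.play, expect_pure]; rfl
  | @activate n D hm next ih =>
    rw [Adversary.play, expect_bind]
    refine le_tsum_pmf_mul A fun τ => le_trans ?_ (ih _ _)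
    rw [← collisionProb_snoc_zero, snoc_one_eq]
    exact collisionProb_mono A (le_update_succ _ _)
  | request j hj next ih =>
    rw [Adversary.play]
    exact (collisionProb_mono A (le_update_succ _ _)).trans (ih _ _)
  | toss μ next ih =>
    rw [Adversary.play, expect_bind]
    exact le_tsum_pmf_mul μ fun r => ih r σ

/-- If all demands are at most `M` at the end of the game, then they are so now. -/
theorem le_of_forall_play_le (A : Algorithm m) {M : ℕ} {D : Fin n → ℕ} (Z : Adversary m D)
    (σ : Fin n → Equiv.Perm (Fin m))
    (h : ∀ o ∈ (Z.play A σ).support, ∀ i, o.2.2 i ≤ M) (i : Fin n) : D i ≤ M := by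
  induction Z with
  | halt => exact h ⟨_, σ, _⟩ (by simp [Adversary.play]) i
  | @activate n D hm next ih =>
    obtain ⟨τ, hτ⟩ := A.support_nonempty
    have := ih (τ ⟨0, hm⟩) (Fin.snoc (α := fun _ => Equiv.Perm (Fin m)) σ τ)
      (fun o ho => h o (by
        rw [Adversary.play, PMF.mem_support_bind_iff]
        exact ⟨τ, hτ, ho⟩)) i.castSucc
    simpa using this
  | request j hj next ih => exact (le_update_succ _ _ i).trans (ih _ σ h i)
  | toss μ next ih =>
    obtain ⟨r, hr⟩ := μ.support_nonempty
    refine ih r σ (fun o ho => h o ?_) i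
    rw [Adversary.play, PMF.mem_support_bind_iff]
    exact ⟨r, hr, ho⟩

theorem histWeight_snoc_zero (A : Algorithm m) (D : Fin n → ℕ) (ρ : Fin n → Fin m → Fin m)
    (r : Fin m → Fin m) (σ : Fin n → Equiv.Perm (Fin m)) (τ : Equiv.Perm (Fin m)) :
    histWeight A (Fin.snoc (α := fun _ => ℕ) D 0) (Fin.snoc (α := fun _ => Fin m → Fin m) ρ r)
      (Fin.snoc (α := fun _ => Equiv.Perm (Fin m)) σ τ) = histWeight A D ρ σ * A τ := by
  unfold histWeight
  have : Agrees (Fin.snoc (α := fun _ => ℕ) D 0) (Fin.snoc (α := fun _ => Fin m → Fin m) ρ r)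
      (Fin.snoc (α := fun _ => Equiv.Perm (Fin m)) σ τ) ↔ Agrees D ρ σ := by
    simp [Agrees, Fin.forall_fin_succ']
  simp only [this, Fin.prod_univ_castSucc, Fin.snoc_castSucc, Fin.snoc_last]
  split_ifs <;> simp

theorem histCollision_snoc_zero {D : Fin n → ℕ} {ρ : Fin n → Fin m → Fin m} {r : Fin m → Fin m}
    (h : HistCollision (Fin.snoc (α := fun _ => Fin m → Fin m) ρ r)
      (Fin.snoc (α := fun _ => ℕ) D 0)) : HistCollision ρ D := by
  obtain ⟨i, j, hij, a, b, ha, hb, e⟩ := h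
  induction i using Fin.lastCases with
  | last => simp at ha
  | cast i =>
    induction j using Fin.lastCases with
    | last => simp at hb
    | cast j =>
      simp only [Fin.snoc_castSucc] at ha hb e
      exact ⟨i, j, fun h => hij (by rw [h]), a, b, ha, hb, e⟩

theorem sum_histWeight_snoc_zero_mul (A : Algorithm m) (D : Fin n → ℕ)
    (ρ : Fin n → Fin m → Fin m) (r : Fin m → Fin m)
    (X : (Fin (n + 1) → Equiv.Perm (Fin m)) → ℝ≥0∞) :
    (∑ σ, histWeight A (Fin.snoc (α := fun _ => ℕ) D 0)
      (Fin.snoc (α := fun _ => Fin m → Fin m) ρ r) σ * X σ) =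
    ∑ σ, histWeight A D ρ σ * ∑' τ, A τ * X (Fin.snoc (α := fun _ => Equiv.Perm (Fin m)) σ τ) := by
  rw [sum_snoc]
  refine Finset.sum_congr rfl fun σ _ => ?_
  rw [tsum_fintype, Finset.mul_sum]
  refine Finset.sum_congr rfl fun τ _ => ?_
  rw [histWeight_snoc_zero, mul_assoc]

/-- The induction is over the strategy with the history left arbitrary. Only collision-free
histories are covered, as `request_inequality` deals with collided continuations without an
induction hypothesis. -/
theorem play_inequality {A : Algorithm m} {M : ℕ} (hA : HazardRegular A M) {D : Fin n → ℕ}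
    (Z : Adversary m D) (ρ : Fin n → Fin m → Fin m) (hρ : ¬ HistCollision ρ D)
    (hM : ∀ σ, histWeight A D ρ σ ≠ 0 → ∀ o ∈ (Z.play A σ).support, ∀ i, o.2.2 i ≤ M) :
    (∑ σ, histWeight A D ρ σ *
        expect (Z.play A σ) fun o => if Collision o.2.1 o.2.2 then 1 else 0) +
      (∑ σ, histWeight A D ρ σ) * collisionProb A ⟨n, D⟩ ≤
    2 * ∑ σ, histWeight A D ρ σ * expect (Z.play A σ) fun o => collisionProb A o.profile := by
  induction Z with
  | @halt n D =>
    have h1 : ∀ σ, histWeight A D ρ σ * (if Collision σ D then (1 : ℝ≥0∞) else 0) = 0 := by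
      intro σ
      by_cases h0 : histWeight A D ρ σ = 0
      · simp [h0]
      · rw [if_neg, mul_zero]
        rwa [(histWeight_ne_zero h0).1.collision_iff]
    simp only [Adversary.play, expect_pure, h1, Finset.sum_const_zero, zero_add,
      ← Finset.sum_mul, Outcome.profile]
    rw [two_mul]
    exact le_self_add
  | @activate n D hm next ih =>
    have hj : (Fin.snoc (α := fun _ => ℕ) D 0 : Fin (n + 1) → ℕ) (Fin.last n) < m := by simpa
    have ht : (⟨_, hj⟩ : Fin m) = ⟨0, hm⟩ := by simp
    have hsupp : ∀ σ : Fin (n + 1) → Equiv.Perm (Fin m),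
        histWeight A (Fin.snoc (α := fun _ => ℕ) D 0)
          (Fin.snoc (α := fun _ => Fin m → Fin m) ρ id) σ ≠ 0 →
        ∀ o ∈ ((next (σ (Fin.last n) ⟨0, hm⟩)).play A σ).support, ∀ i, o.2.2 i ≤ M := by
      intro σ hσ o ho
      rw [← Fin.snoc_init_self σ, histWeight_snoc_zero] at hσ
      refine hM (Fin.init σ) (left_ne_zero_of_mul hσ) o ?_
      rw [Adversary.play, PMF.mem_support_bind_iff]
      refine ⟨σ (Fin.last n), (PMF.mem_support_iff _ _).2 (right_ne_zero_of_mul hσ), ?_⟩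
      rwa [Fin.snoc_init_self]
    -- The row `id` is a dummy record for the new instance; at demand 0 none of its entries is
    -- consulted.
    have key := request_inequality hA hj (snoc_one_eq D)
      (ρ := Fin.snoc (α := fun _ => Fin m → Fin m) ρ id)
      (fun h => hρ (histCollision_snoc_zero h))
      (fun σ hσ => le_of_forall_play_le A (next (σ (Fin.last n) ⟨0, hm⟩)) σ
        (hsupp σ hσ))
      (fun x σ => expect ((next x).play A σ) fun o => if Collision o.2.1 o.2.2 then 1 else 0)
      (fun x σ => expect ((next x).play A σ) fun o => collisionProb A o.profile)
      (fun x σ => expect_le_one _ fun o => by split_ifs <;> simp)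
      (fun x σ => collisionProb_le_expect_play A (next x) σ)
      (fun x hx => ih x _ hx fun σ hσ => by
        have hσ' := hσ
        rw [snoc_one_eq, histWeight_extend] at hσ'
        split_ifs at hσ' with hx'
        · rw [← hx', ht]
          exact hsupp σ hσ'
        · exact absurd rfl hσ')
    simp only [ht] at key
    rw [sum_histWeight_snoc_zero_mul A D ρ id fun σ => expect
        ((next (σ (Fin.last n) ⟨0, hm⟩)).play A σ) fun o => if Collision o.2.1 o.2.2 then 1 else 0,
      sum_histWeight_snoc_zero_mul A D ρ id fun σ => expect
        ((next (σ (Fin.last n) ⟨0, hm⟩)).play A σ) fun o => collisionProb A o.profile,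
      collisionProb_snoc_zero] at key
    have hone := sum_histWeight_snoc_zero_mul A D ρ id fun _ => 1
    simp only [mul_one, A.tsum_coe] at hone
    rw [hone] at key
    simpa only [Adversary.play, expect_bind, Fin.snoc_last] using key
  | @request n D j hj next ih =>
    refine request_inequality hA hj rfl hρ
      (fun σ hσ => le_of_forall_play_le A (next (σ j ⟨D j, hj⟩)) σ (hM σ hσ))
      (fun x σ => expect ((next x).play A σ) fun o => if Collision o.2.1 o.2.2 then 1 else 0)
      (fun x σ => expect ((next x).play A σ) fun o => collisionProb A o.profile)
      (fun x σ => expect_le_one _ fun o => by split_ifs <;> simp)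
      (fun x σ => collisionProb_le_expect_play A (next x) σ)
      (fun x hx => ih x _ hx fun σ hσ => ?_)
    rw [histWeight_extend] at hσ
    split_ifs at hσ with hx'
    · subst hx'
      exact hM σ hσ
    · exact absurd rfl hσ
  | @toss n D μ next ih =>
    have e : ∀ f : Outcome m → ℝ≥0∞, (∑ σ, histWeight A D ρ σ *
        expect ((Adversary.toss μ next).play A σ) f) =
        ∑' r, μ r * ∑ σ, histWeight A D ρ σ * expect ((next r).play A σ) f := by
      intro f
      simp only [Adversary.play, expect_bind, Finset.mul_sum, ← ENNReal.tsum_mul_left]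
      rw [Summable.tsum_finsetSum fun _ _ => ENNReal.summable]
      refine Finset.sum_congr rfl fun σ _ => tsum_congr fun r => ?_
      ring
    have e2 : (∑ σ, histWeight A D ρ σ) * collisionProb A ⟨n, D⟩ =
        ∑' r, μ r * ((∑ σ, histWeight A D ρ σ) * collisionProb A ⟨n, D⟩) := by
      rw [ENNReal.tsum_mul_right, μ.tsum_coe, one_mul]
    rw [e, e, e2, ← ENNReal.tsum_add, ← ENNReal.tsum_mul_left]
    refine ENNReal.tsum_le_tsum fun r => ?_
    by_cases hr : μ r = 0
    · simp [hr]
    rw [← mul_add, mul_left_comm]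
    gcongr
    refine ih r ρ hρ fun σ hσ o ho => hM σ hσ o ?_
    rw [Adversary.play, PMF.mem_support_bind_iff]
    exact ⟨r, (PMF.mem_support_iff _ _).2 hr, ho⟩

/-! ### From the potential to competitive ratios -/

theorem adaptiveCollisionProb_le {A : Algorithm m} {M : ℕ} (hA : HazardRegular A M)
    (Z : Adaptive m) (hM : ∀ o ∈ (game A Z).support, ∀ i, o.2.2 i ≤ M) :
    adaptiveCollisionProb A Z ≤ 2 * ∑' o, game A Z o * collisionProb A o.profile := by
  have key := play_inequality hA Z ![] (fun ⟨i, _⟩ => i.elim0) (fun σ _ => by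
    rw [Subsingleton.elim σ ![]]
    exact hM)
  have h1 : ∀ f : (Fin 0 → Equiv.Perm (Fin m)) → ℝ≥0∞,
      ∑ σ, histWeight A (![] : Fin 0 → ℕ) ![] σ * f σ = f ![] := by
    intro f
    rw [Fintype.sum_subsingleton _ ![]]
    have : Agrees (![] : Fin 0 → ℕ) ![] (![] : Fin 0 → Equiv.Perm (Fin m)) := fun i => i.elim0
    simp [histWeight, this]
  rw [h1, h1] at key
  -- The potential of the starting position is simply dropped.
  refine le_trans ?_ (le_self_add.trans key)
  unfold adaptiveCollisionProb expect game
  simp only [mul_ite, mul_one, mul_zero, le_refl]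

theorem adaptiveCompetitiveRatio_le {A : Algorithm m} {M : ℕ} (hA : HazardRegular A M)
    {𝒟 : Set Profile} (hM : ∀ D ∈ 𝒟, ∀ i, D.2 i ≤ M) :
    adaptiveCompetitiveRatio A 𝒟 ≤ 2 * competitiveRatio A 𝒟 := by
  by_cases htop : competitiveRatio A 𝒟 = ⊤
  · rw [htop, ENNReal.mul_top (by norm_num)]
    exact le_top
  refine iSup₂_le fun Z hZ => ENNReal.div_le_of_le_mul ?_
  refine (adaptiveCollisionProb_le hA Z fun o ho => hM _ (hZ o ho)).trans ?_
  rw [mul_assoc]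
  gcongr
  rw [expectedOptProb, ← ENNReal.tsum_mul_left]
  refine ENNReal.tsum_le_tsum fun o => ?_
  by_cases ho : game A Z o = 0
  · simp [ho]
  rw [mul_left_comm]
  gcongr
  have hle : collisionProb A o.profile / optProb m o.profile ≤ competitiveRatio A 𝒟 :=
    le_iSup₂ (f := fun D (_ : D ∈ 𝒟) => collisionProb A D / optProb m D) o.profile
      (hZ o ((PMF.mem_support_iff _ _).2 ho))
  have hp : optProb m o.profile ≠ ⊤ := by
    have h1 : collisionProb A o.profile ≤ 1 := by
      rw [← collisionProb_add_noCollisionProb A o.profile.2]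
      exact le_self_add
    exact ne_top_of_le_ne_top ENNReal.one_ne_top ((iInf_le _ A).trans h1)
  -- A vanishing `optProb` does no harm: with a finite ratio it forces the numerator to vanish too.
  exact (ENNReal.div_le_iff_le_mul (Or.inr htop) (Or.inl hp)).1 hle

/-! ### Comparing probabilities by injections -/

theorem sum_ite_eq_toOuterMeasure (A : Algorithm m) (P : Equiv.Perm (Fin m) → Prop)
    [DecidablePred P] : (∑ τ, if P τ then A τ else 0) = A.toOuterMeasure {τ | P τ} := by
  rw [PMF.toOuterMeasure_apply_fintype]
  refine Finset.sum_congr rfl fun τ _ => ?_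
  simp [Set.indicator_apply]

theorem uniform_toOuterMeasure_le {α : Type*} [Fintype α] [Nonempty α] {s t : Set α} (g : α → α)
    (hg : Set.MapsTo g s t) (hinj : Set.InjOn g s) :
    (PMF.uniformOfFintype α).toOuterMeasure s ≤ (PMF.uniformOfFintype α).toOuterMeasure t := by
  rw [PMF.toOuterMeasure_uniformOfFintype_apply, PMF.toOuterMeasure_uniformOfFintype_apply]
  gcongr
  exact Fintype.card_le_of_injective _ (hg.restrict_inj.2 hinj)

/-- Symmetry turns one-sided comparisons into equality, so uniformity needs only an injection from
each event into each other. -/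
theorem exists_forall_eq_of_forall_le {α β : Type*} [PartialOrder β] [Nonempty β] {P : α → Prop}
    {f : α → β} (h : ∀ x y, P x → P y → f x ≤ f y) : ∃ u, ∀ x, P x → f x = u := by
  by_cases hP : ∃ x, P x
  · obtain ⟨x, hx⟩ := hP
    exact ⟨f x, fun y hy => le_antisymm (h y x hy hx) (h x y hx hy)⟩
  · exact ⟨Classical.arbitrary β, fun x hx => absurd ⟨x, hx⟩ hP⟩

/-! ### `BINS(k)` -/

section Bins

variable {k : ℕ} (π : Equiv.Perm (Fin (m / k))) {a : Fin m}

theorem binsPerm_div (hk : 0 < k) (h : (a : ℕ) / k < m / k) :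
    (binsPerm m k π a : ℕ) / k = π ⟨a / k, h⟩ := by
  simp only [binsPerm, Equiv.coe_fn_mk, binsFun, h, dite_true]
  rw [Nat.add_comm, Nat.add_mul_div_right _ _ hk, Nat.div_eq_of_lt (Nat.mod_lt _ hk), Nat.zero_add]

theorem binsPerm_mod (h : (a : ℕ) / k < m / k) :
    (binsPerm m k π a : ℕ) % k = (a : ℕ) % k := by
  simp only [binsPerm, Equiv.coe_fn_mk, binsFun, h, dite_true]
  rw [Nat.add_comm, Nat.add_mul_mod_self_right, Nat.mod_mod]

theorem binsPerm_leftover (h : ¬ (a : ℕ) / k < m / k) : binsPerm m k π a = a := by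
  ext
  simp [binsPerm, binsFun, h]

theorem binsPerm_div_lt_iff (hk : 0 < k) :
    (binsPerm m k π a : ℕ) / k < m / k ↔ (a : ℕ) / k < m / k := by
  by_cases h : (a : ℕ) / k < m / k
  · simp only [binsPerm_div π hk h, Fin.is_lt, h]
  · rw [binsPerm_leftover π h]

end Bins

theorem ext_div_mod {k : ℕ} {a b : Fin m} (h : (a : ℕ) / k = (b : ℕ) / k)
    (h' : (a : ℕ) % k = (b : ℕ) % k) : a = b := by
  ext
  rw [← Nat.div_add_mod (a : ℕ) k, ← Nat.div_add_mod (b : ℕ) k, h, h']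

/-- The first ID of the bin of `a`. -/
def binStart (k : ℕ) (a : Fin m) : Fin m :=
  ⟨(a : ℕ) / k * k, (Nat.div_mul_le_self _ _).trans_lt a.isLt⟩

theorem binStart_le (k : ℕ) (a : Fin m) : binStart k a ≤ a := Nat.div_mul_le_self _ _

theorem binStart_div {k : ℕ} (hk : 0 < k) (a : Fin m) :
    (binStart k a : ℕ) / k = (a : ℕ) / k := Nat.mul_div_cancel _ hk

theorem binStart_mod (k : ℕ) (a : Fin m) : (binStart k a : ℕ) % k = 0 := Nat.mul_mod_left _ _

theorem mem_support_bins {k : ℕ} {σ : Equiv.Perm (Fin m)} :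
    σ ∈ (bins m k).support ↔ ∃ π, binsPerm m k π = σ := by
  simp [bins]

/-- Within a bin, a shared ID means a shared bin, whose first ID both instances returned no later,
and `t`'s instance strictly earlier. Among the leftovers, all bins are already exhausted. -/
theorem bins_forced {k : ℕ} (hk : 0 < k) (hkm : k ≤ m) {t : Fin m}
    (ht : ¬ ((t : ℕ) % k = 0 ∧ (t : ℕ) / k < m / k)) (π π' : Equiv.Perm (Fin (m / k)))
    {b : Fin m} (e : binsPerm m k π' b = binsPerm m k π t) :
    ∃ a < t, ∃ b' ≤ b, binsPerm m k π a = binsPerm m k π' b' := by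
  by_cases h : (t : ℕ) / k < m / k
  · have hb : (b : ℕ) / k < m / k := by
      rw [← binsPerm_div_lt_iff π' hk, e, binsPerm_div_lt_iff π hk]
      exact h
    have ht0 : (t : ℕ) % k ≠ 0 := fun h0 => ht ⟨h0, h⟩
    have hs : (binStart k t : ℕ) / k < m / k := by rwa [binStart_div hk]
    have hs' : (binStart k b : ℕ) / k < m / k := by rwa [binStart_div hk]
    refine ⟨binStart k t, ?_, binStart k b, binStart_le k b, ?_⟩
    · refine lt_of_le_of_ne (binStart_le k t) fun e => ht0 ?_
      rw [← e, binStart_mod]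
    · refine ext_div_mod (k := k) ?_ ?_
      · rw [binsPerm_div π hk hs, binsPerm_div π' hk hs']
        simp only [binStart_div hk]
        rw [← binsPerm_div π hk h, ← binsPerm_div π' hk hb, e]
      · rw [binsPerm_mod π hs, binsPerm_mod π' hs', binStart_mod, binStart_mod]
  · have hm : 0 < m := hk.trans_le hkm
    set z : Fin m := ⟨0, hm⟩
    -- The very first ID of the other instance lies in a bin, hence was returned before the leftover
    -- time `t`.
    refine ⟨(binsPerm m k π).symm (binsPerm m k π' z), ?_, z, Nat.zero_le _, by simp⟩
    have h1 : ((binsPerm m k π).symm (binsPerm m k π' z) : ℕ) / k < m / k := by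
      rw [← binsPerm_div_lt_iff π hk, Equiv.apply_symm_apply, binsPerm_div_lt_iff π' hk]
      simpa [z] using Nat.div_pos hkm hk
    rw [Fin.lt_def]
    by_contra hlt
    exact h (lt_of_le_of_lt (Nat.div_le_div_right (not_lt.1 hlt)) h1)

/-- Exchanging the bins of `x` and `y` in the order `π` maps the first event into the second. The
past is untouched: the bin of `x` comes only at time `t`, and an earlier ID from the bin of `y`
would have been preceded by `y` itself. -/
theorem bins_uniform {k : ℕ} (hk : 0 < k) {t : Fin m} (ht0 : (t : ℕ) % k = 0)
    (htk : (t : ℕ) / k < m / k) {ρ : Fin m → Fin m} {x y : Fin m}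
    (hy0 : (y : ℕ) % k = 0) (hyk : (y : ℕ) / k < m / k) (hxk : (x : ℕ) / k < m / k)
    (hy : ∀ a < t, ρ a ≠ y) :
    (bins m k).toOuterMeasure {τ | (∀ a < t, τ a = ρ a) ∧ τ t = x} ≤
      (bins m k).toOuterMeasure {τ | (∀ a < t, τ a = ρ a) ∧ τ t = y} := by
  rw [bins, PMF.toOuterMeasure_map_apply, PMF.toOuterMeasure_map_apply]
  refine uniform_toOuterMeasure_le (fun π => Equiv.swap ⟨x / k, hxk⟩ ⟨y / k, hyk⟩ * π) ?_
    (fun π _ π' _ h => mul_left_cancel h)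
  rintro π ⟨hπ, hx⟩
  have hπt : π ⟨t / k, htk⟩ = ⟨x / k, hxk⟩ := by
    ext
    rw [← binsPerm_div π hk htk, hx]
  refine ⟨fun a ha => ?_, ?_⟩
  · rw [← hπ a ha]
    have hta : (a : ℕ) / k < (t : ℕ) / k := by
      rw [Nat.div_lt_iff_lt_mul hk, Nat.div_mul_cancel (Nat.dvd_of_mod_eq_zero ht0)]
      exact ha
    have hak := hta.trans htk
    refine ext_div_mod (k := k) ?_ (by rw [binsPerm_mod _ hak, binsPerm_mod _ hak])
    rw [binsPerm_div _ hk hak, binsPerm_div _ hk hak, Equiv.Perm.mul_apply,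
      Equiv.swap_apply_of_ne_of_ne]
    · rw [← hπt]
      intro h
      have := congrArg Fin.val (π.injective h)
      simp only at this
      omega
    · intro h
      have hsk : (binStart k a : ℕ) / k < m / k := by rwa [binStart_div hk]
      have hs := (binStart_le k a).trans_lt ha
      apply hy (binStart k a) hs
      rw [← hπ _ hs]
      refine ext_div_mod (k := k) ?_ ?_
      · rw [binsPerm_div _ hk hsk]
        simp only [binStart_div hk, h]
      · rw [binsPerm_mod _ hsk, binStart_mod, hy0]
  · refine ext_div_mod (k := k) ?_ ?_
    · rw [binsPerm_div _ hk htk, Equiv.Perm.mul_apply, hπt, Equiv.swap_apply_left]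
    · rw [binsPerm_mod _ htk, ht0, hy0]

theorem hazardRegular_bins {k : ℕ} (hk : 0 < k) (hkm : k ≤ m) : HazardRegular (bins m k) m := by
  intro t _
  by_cases ht : (t : ℕ) % k = 0 ∧ (t : ℕ) / k < m / k
  · right
    set G : Finset (Fin m) := univ.filter fun a : Fin m => (a : ℕ) % k = 0 ∧ (a : ℕ) / k < m / k
      with hG
    -- One set serves for both IDs and times, since `binsPerm` maps starts of full bins to starts of
    -- full bins.
    refine ⟨G, G, by simpa [hG] using ht, ?_, fun ρ => ?_⟩
    · intro σ hσ a _
      obtain ⟨π, rfl⟩ := mem_support_bins.1 hσ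
      simp only [hG, mem_filter, mem_univ, true_and, binsPerm_div_lt_iff π hk]
      refine and_congr_left fun h => ?_
      rw [binsPerm_mod π h]
    · obtain ⟨u, hu⟩ := exists_forall_eq_of_forall_le
        (P := fun x => x ∈ G ∧ ∀ a < t, ρ a ≠ x)
        (f := fun x => (bins m k).toOuterMeasure {τ | (∀ a < t, τ a = ρ a) ∧ τ t = x})
        (by
          rintro x y ⟨hxG, -⟩ ⟨hyG, hy⟩
          simp only [hG, mem_filter, mem_univ, true_and] at hxG hyG
          exact bins_uniform hk ht.1 ht.2 hyG.1 hyG.2 hxG.2 hy)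
      exact ⟨u, fun x hx hx' => (sum_ite_eq_toOuterMeasure _ _).trans (hu x ⟨hx, hx'⟩)⟩
  · left
    intro σ hσ τ hτ b _ e
    obtain ⟨π, rfl⟩ := mem_support_bins.1 hσ
    obtain ⟨π', rfl⟩ := mem_support_bins.1 hτ
    exact bins_forced hk hkm ht π π' e

/-! ### `BINS*` -/

theorem exists_time_eq {m a : ℕ} (ha : a < 2 ^ chunks m - 1) :
    ∃ (i : Fin (chunks m)) (j : Fin (2 ^ (i : ℕ))), a = 2 ^ (i : ℕ) - 1 + j := by
  -- Bin `i` occupies the times `a` with `2 ^ i ≤ a + 1 < 2 ^ (i + 1)`, so `i` is the binary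
  -- logarithm of `a + 1`.
  have h1 : 2 ^ Nat.log 2 (a + 1) ≤ a + 1 := Nat.pow_log_le_self 2 (by omega)
  have h2 : a + 1 < 2 ^ (Nat.log 2 (a + 1) + 1) := Nat.lt_pow_succ_log_self (by norm_num) _
  have h3 : Nat.log 2 (a + 1) < chunks m := Nat.log_lt_of_lt_pow (by omega) (by omega)
  have h4 : 0 < 2 ^ Nat.log 2 (a + 1) := by positivity
  rw [pow_succ] at h2
  exact ⟨⟨_, h3⟩, ⟨a + 1 - 2 ^ Nat.log 2 (a + 1), by simp only; omega⟩, by simp only; omega⟩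

theorem mul_pow_add_lt {C i b j : ℕ} (hi : i < C) (hb : b < 2 ^ (C - 1 - i)) (hj : j < 2 ^ i) :
    b * 2 ^ i + j < 2 ^ (C - 1) := by
  have h1 : (b + 1) * 2 ^ i ≤ 2 ^ (C - 1 - i) * 2 ^ i := Nat.mul_le_mul_right _ hb
  rw [← pow_add, Nat.sub_add_cancel (by omega), Nat.add_mul] at h1
  omega

/-- The position of an ID determines its chunk, its bin, and its place in the bin. -/
theorem chunk_bin_unique {C i i' b b' j j' : ℕ} (hi : i < C) (hb : b < 2 ^ (C - 1 - i))
    (hj : j < 2 ^ i) (hi' : i' < C) (hb' : b' < 2 ^ (C - 1 - i')) (hj' : j' < 2 ^ i')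
    (e : i * 2 ^ (C - 1) + b * 2 ^ i + j = i' * 2 ^ (C - 1) + b' * 2 ^ i' + j') :
    i = i' ∧ b = b' ∧ j = j' := by
  have h1 := mul_pow_add_lt hi hb hj
  have h2 := mul_pow_add_lt hi' hb' hj'
  have aux : ∀ {q r d : ℕ}, r < d → (q * d + r) / d = q := by
    intro q r d h
    rw [Nat.add_comm, Nat.add_mul_div_right _ _ (by omega), Nat.div_eq_of_lt h, Nat.zero_add]
  have hii : i = i' := by
    rw [← aux (q := i) h1, ← Nat.add_assoc, e, Nat.add_assoc, aux h2]
  subst hii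
  have e' : b * 2 ^ i + j = b' * 2 ^ i + j' := by omega
  have hbb : b = b' := by
    rw [← aux (q := b) hj, e', aux hj']
  subst hbb
  exact ⟨rfl, rfl, by omega⟩

theorem IsBinsStar.exists_bins {A : Algorithm m} (hA : IsBinsStar A) {σ : Equiv.Perm (Fin m)}
    (hσ : σ ∈ A.support) :
    ∃ b : (i : Fin (chunks m)) → Fin (2 ^ (chunks m - 1 - (i : ℕ))),
      ∀ (i : Fin (chunks m)) (j : Fin (2 ^ (i : ℕ))),
        (σ ⟨2 ^ (i : ℕ) - 1 + (j : ℕ), time_lt i j⟩ : ℕ) =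
          (i : ℕ) * 2 ^ (chunks m - 1) + (b i : ℕ) * 2 ^ (i : ℕ) + (j : ℕ) := by
  have h := (PMF.mem_support_map_iff
    (f := fun (σ : Equiv.Perm (Fin m)) (i : Fin (chunks m)) (j : Fin (2 ^ (i : ℕ))) =>
      (σ ⟨2 ^ (i : ℕ) - 1 + (j : ℕ), time_lt i j⟩ : ℕ)) A _).2 ⟨σ, hσ, rfl⟩
  rw [hA, PMF.mem_support_map_iff] at h
  obtain ⟨b, -, hb⟩ := h
  exact ⟨b, fun i j => (congrFun (congrFun hb i) j).symm⟩

/-- An ID determines its chunk and bin, so two instances sharing an ID took the same bin and already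
share its first ID. -/
theorem IsBinsStar.forced {A : Algorithm m} (hA : IsBinsStar A) {t : Fin m}
    {i : Fin (chunks m)} {j : Fin (2 ^ (i : ℕ))} (ht : (t : ℕ) = 2 ^ (i : ℕ) - 1 + j)
    (hj : (j : ℕ) ≠ 0) {σ τ : Equiv.Perm (Fin m)} (hσ : σ ∈ A.support) (hτ : τ ∈ A.support)
    {b : Fin m} (hb : (b : ℕ) < 2 ^ chunks m - 1) (e : τ b = σ t) :
    ∃ a < t, ∃ b' ≤ b, σ a = τ b' := by
  obtain ⟨β, hβ⟩ := hA.exists_bins hσ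
  obtain ⟨γ, hγ⟩ := hA.exists_bins hτ
  obtain ⟨i', j', hb'⟩ := exists_time_eq hb
  obtain rfl : t = ⟨_, time_lt i j⟩ := Fin.ext ht
  obtain rfl : b = ⟨_, time_lt i' j'⟩ := Fin.ext hb'
  have e' := congrArg Fin.val e
  rw [hβ, hγ] at e'
  obtain ⟨h1, h2, h3⟩ := chunk_bin_unique i'.isLt (γ i').isLt j'.isLt i.isLt (β i).isLt j.isLt e'
  obtain rfl : i' = i := Fin.ext h1
  have hβ0 := hβ i' ⟨0, by positivity⟩
  have hγ0 := hγ i' ⟨0, by positivity⟩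
  refine ⟨_, ?_, _, ?_, Fin.ext (hβ0.trans (Eq.trans ?_ hγ0.symm))⟩
  · simp only [Fin.lt_def]
    omega
  · simp only [Fin.le_def]
    omega
  · rw [h2]

/-- The bin of chunk `i` is independent of those of the earlier chunks, hence of the whole past at
time `t`. Resetting coordinate `i` to `s` is injective on the first event, where that coordinate is
always `r`. -/
theorem IsBinsStar.uniform {A : Algorithm m} (hA : IsBinsStar A) {t : Fin m}
    {i : Fin (chunks m)} (ht : (t : ℕ) = 2 ^ (i : ℕ) - 1) {ρ : Fin m → Fin m} {x y : Fin m}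
    {r s : Fin (2 ^ (chunks m - 1 - (i : ℕ)))}
    (hx : (x : ℕ) = i * 2 ^ (chunks m - 1) + r * 2 ^ (i : ℕ))
    (hy : (y : ℕ) = i * 2 ^ (chunks m - 1) + s * 2 ^ (i : ℕ)) :
    A.toOuterMeasure {τ | (∀ a < t, τ a = ρ a) ∧ τ t = x} ≤
      A.toOuterMeasure {τ | (∀ a < t, τ a = ρ a) ∧ τ t = y} := by
  -- The event concerns only times below `2 ^ C - 1`, so it can be expressed through the map whose
  -- law `IsBinsStar` prescribes, whatever the completion of the order.
  have hpre : ∀ z : Fin m, {τ : Equiv.Perm (Fin m) | (∀ a < t, τ a = ρ a) ∧ τ t = z} =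
      (fun (σ : Equiv.Perm (Fin m)) (i : Fin (chunks m)) (j : Fin (2 ^ (i : ℕ))) =>
        (σ ⟨2 ^ (i : ℕ) - 1 + (j : ℕ), time_lt i j⟩ : ℕ)) ⁻¹'
      {f | (∀ (i' : Fin (chunks m)) (j' : Fin (2 ^ (i' : ℕ))), 2 ^ (i' : ℕ) - 1 + (j' : ℕ) < t →
        f i' j' = ρ ⟨_, time_lt i' j'⟩) ∧ f i ⟨0, by positivity⟩ = z} := by
    intro z
    ext τ
    simp only [Set.mem_ofPred_eq, Set.mem_preimage]
    refine and_congr ⟨fun h i' j' hlt => ?_, fun h a ha => ?_⟩ ?_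
    · rw [h ⟨_, time_lt i' j'⟩ hlt]
    · have hle : 2 ^ (i : ℕ) ≤ 2 ^ chunks m := Nat.pow_le_pow_right (by norm_num) i.isLt.le
      obtain ⟨i', j', e⟩ := exists_time_eq (m := m) (a := a) (by
        have := Fin.lt_def.1 ha
        omega)
      obtain rfl : a = ⟨_, time_lt i' j'⟩ := Fin.ext e
      exact Fin.ext (h i' j' ha)
    · obtain rfl : t = ⟨_, time_lt i ⟨0, by positivity⟩⟩ := Fin.ext (by simpa using ht)
      exact Fin.ext_iff
  rw [hpre x, hpre y, ← PMF.toOuterMeasure_map_apply, ← PMF.toOuterMeasure_map_apply, hA,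
    PMF.toOuterMeasure_map_apply, PMF.toOuterMeasure_map_apply]
  refine uniform_toOuterMeasure_le (fun b => Function.update b i s) ?_ ?_
  · rintro b ⟨h1, h2⟩
    refine ⟨fun i' j' hlt => ?_, ?_⟩
    · have hne : i' ≠ i := by
        rintro rfl
        omega
      have := h1 i' j' hlt
      simpa only [Function.update_of_ne hne] using this
    · simp [hy]
  · have hr : ∀ b : (i : Fin (chunks m)) → Fin (2 ^ (chunks m - 1 - (i : ℕ))),
        (i : ℕ) * 2 ^ (chunks m - 1) + (b i : ℕ) * 2 ^ (i : ℕ) + 0 = x → b i = r := by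
      intro b h
      rw [hx] at h
      exact Fin.ext (Nat.eq_of_mul_eq_mul_right (by positivity) (by omega :
        (b i : ℕ) * 2 ^ (i : ℕ) =
        r * 2 ^ (i : ℕ)))
    rintro b ⟨-, h2⟩ b' ⟨-, h2'⟩ e
    funext i'
    by_cases hne : i' = i
    · subst hne
      rw [hr b h2, hr b' h2']
    · have := congrFun e i'
      simpa only [Function.update_of_ne hne] using this

theorem IsBinsStar.hazardRegular {A : Algorithm m} (hA : IsBinsStar A) :
    HazardRegular A (2 ^ chunks m - 1) := by
  intro t ht
  obtain ⟨i, j, htij⟩ := exists_time_eq ht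
  by_cases hj : (j : ℕ) = 0
  · right
    rw [hj, Nat.add_zero] at htij
    set G : Finset (Fin m) := univ.filter fun x : Fin m =>
      ∃ r : Fin (2 ^ (chunks m - 1 - (i : ℕ))),
        (x : ℕ) = i * 2 ^ (chunks m - 1) + r * 2 ^ (i : ℕ) with hG
    -- Each chunk supplies a single bin, so the set of bin starts of chunk `i` is hit exactly once,
    -- at time `t`.
    refine ⟨G, {t}, mem_singleton_self t, ?_, fun ρ => ?_⟩
    · intro σ hσ a ha
      obtain ⟨b, hb⟩ := hA.exists_bins hσ
      obtain ⟨i', j', ha'⟩ := exists_time_eq ha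
      obtain rfl : a = ⟨_, time_lt i' j'⟩ := Fin.ext ha'
      simp only [hG, mem_filter, mem_univ, true_and, mem_singleton, hb, Fin.ext_iff, htij]
      constructor
      · rintro ⟨r, hr⟩
        obtain ⟨h1, -, h3⟩ := chunk_bin_unique i'.isLt (b i').isLt j'.isLt i.isLt r.isLt
          (j' := 0) (by positivity) hr
        rw [h3, h1, Nat.add_zero]
      -- The two inequalities of powers give `i' < i + 1` and `i < i' + 1`: the starting time of a
      -- bin identifies its chunk.
      · intro h
        have h1 : (2 : ℕ) ^ (i' : ℕ) < 2 ^ ((i : ℕ) + 1) := by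
          have : 0 < 2 ^ (i : ℕ) := by positivity
          rw [pow_succ]
          omega
        have h2 : (2 : ℕ) ^ (i : ℕ) < 2 ^ ((i' : ℕ) + 1) := by
          have : 0 < 2 ^ (i' : ℕ) := by positivity
          have := j'.isLt
          rw [pow_succ]
          omega
        rw [Nat.pow_lt_pow_iff_right (by norm_num)] at h1 h2
        obtain rfl : i' = i := Fin.ext (by omega)
        exact ⟨b i', by omega⟩
    · obtain ⟨u, hu⟩ := exists_forall_eq_of_forall_le (P := fun x => x ∈ G)
        (f := fun x => A.toOuterMeasure {τ | (∀ a < t, τ a = ρ a) ∧ τ t = x})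
        (by
          intro x y hx hy
          simp only [hG, mem_filter, mem_univ, true_and] at hx hy
          obtain ⟨r, hr⟩ := hx
          obtain ⟨s, hs⟩ := hy
          exact hA.uniform htij hr hs)
      exact ⟨u, fun x hx _ => (sum_ite_eq_toOuterMeasure _ _).trans (hu x hx)⟩
  · left
    intro σ hσ τ hτ b hb e
    exact hA.forced htij hj hσ hτ hb e

end UUID

end

open UUID in
/-- Let `A` be `BINS(k)` for some `k ∈ {1, …, m}`, or `BINS*`; in the latter case the profiles
request no more IDs from an instance than `BINS*` specifies, which are `2 ^ C - 1`. -/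
theorem mainTheorem10 (m : ℕ) (A : Algorithm m) (𝒟 : Set Profile)
    (h𝒟 : ∀ D ∈ 𝒟, D.Nontrivial m)
    (hA : (∃ k : ℕ, 1 ≤ k ∧ k ≤ m ∧ A = bins m k) ∨
      (IsBinsStar A ∧ ∀ D ∈ 𝒟, ∀ i, D.2 i ≤ 2 ^ chunks m - 1))
    (c : ENNReal) (hc : competitiveRatio A 𝒟 = c) :
    adaptiveCompetitiveRatio A 𝒟 ≤ 4 * c := by
  have h : adaptiveCompetitiveRatio A 𝒟 ≤ 2 * competitiveRatio A 𝒟 := by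
    rcases hA with ⟨k, hk, hkm, rfl⟩ | ⟨hA, hM⟩
    · exact adaptiveCompetitiveRatio_le (hazardRegular_bins hk hkm)
        fun D hD i => ((h𝒟 D hD).2 i).2
    · exact adaptiveCompetitiveRatio_le hA.hazardRegular hM
  rw [hc] at h
  refine h.trans ?_
  gcongr
  norm_num
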